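/- Let $\Omega\subset\mathbb{R}^n$ be a bounded open set with $C^{1,1}$ boundary, let $M\in\mathbb{R}^{n\times n}$, and for a fixed temperature $\theta>0$ let $$K=\begin{cases}\alpha(\theta)\,SO(n), & \theta>\theta_c,\\ \bigcup_{j=1}^m SO(n)\,U_j(\theta), & \theta\le\theta_c,\end{cases}$$ where $\theta_c>0$, $\alpha:(0,\infty)\to(0,\infty)$ and the matrices $U_j(\theta)\in\mathbb{R}^{n\times n}$ are symmetric. Let $1<p\le 2$ and, for $\epsilon>0$, put $$E_{\epsilon,p}=\inf\left\{\int_\Omega \operatorname{dist}^2(\nabla u,K)\,dx+\epsilon^p\|\nabla^2u\|_{L^p(\Omega)}^p\right\},$$ the infimum being taken over all weakly differentiable $u:\mathbb{R}^n\to\mathbb{R}^n$ with $\nabla u=M$ a.e. in $\mathbb{R}^n\setminus\overline\Omega$ (with $\|\nabla^2u\|_{L^p(\Omega)}=\infty$ if the weak second derivative of $u$ in $\Omega$ does not exist in $L^p(\Omega)$). Assume that there are constants $C_p>1$, $\epsilon_0>0$ and $\mu\in(0,\tfrac12)$ such that $$\epsilon^{2\mu}\le C_p\,E_{\epsilon,p}\qquad\text{for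 all }\epsilon\in(0,\epsilon_0).$$ Let $u:\mathbb{R}^n\to\mathbb{R}^n$ be a weakly differentiable solution of $$\nabla u\in K\ \text{ a.e. in }\Omega,\qquad \nabla u=M\ \text{ a.e. in }\mathbb{R}^n\setminus\overline\Omega.$$ Suppose that for some $b\in\mathbb{R}^n$ and $s\in\mathbb{R}$ the function $v(x)=u(x)-Mx-b$ satisfies $v\in W^{1+s,p}(\mathbb{R}^n)$, $\operatorname{supp}(v)\subset\overline\Omega$ and $\nabla v\in L^\infty(\mathbb{R}^n)$. Then $s\le\frac{2\mu}{p}$. Here, for $t=k+\sigma$ with $k\in\{0,1,2,\dots\}$ and $\sigma\in[0,1)$, $W^{t,p}(\mathbb{R}^n)$ is the Sobolev–Slobodeckij space of all functions whose weak derivatives up to order $k$ are in $L^p(\mathbb{R}^n)$ and which, if $\sigma>0$, satisfy $\iint\frac{|\nabla^ku(x)-\nabla^ku(y)|^p}{|x-y|^{n+\sigma p}}\,dy\,dx<\infty$; for $t<0$, $W^{t,p}(\mathbb{R}^n)$ is the dual of $W^{-t,p'}(\mathbb{R}^n)$, $\frac1p+\frac1{p'}=1$. -/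

import Mathlib

open MeasureTheory Set
open scoped ENNReal Matrix Matrix.Norms.Frobenius RealInnerProductSpace

namespace WellScaling

/-- Euclidean space `ℝⁿ`. -/
abbrev Rn (n : ℕ) : Type := EuclideanSpace ℝ (Fin n)

/-- The values of the `k`-th derivative of a map `ℝⁿ → ℝⁿ`: the entry at `(j₁, …, j_k)` is the vector
`∂_{j₁} ⋯ ∂_{j_k} u`. The norm is the Euclidean (Frobenius) norm of all the entries. -/
abbrev Tensor (n k : ℕ) : Type := PiLp 2 (fun _ : Fin k → Fin n => Rn n)

/-- A test function on `U`: smooth, real-valued, with compact support contained in `U`. -/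
def IsTestFunction {n : ℕ} (U : Set (Rn n)) (φ : Rn n → ℝ) : Prop :=
  ContDiff ℝ (⊤ : ℕ∞) φ ∧ HasCompactSupport φ ∧ tsupport φ ⊆ U

/-- `D` is the weak derivative `∇ᵏu` of order `k` of `u` on the open set `U`: both are locally integrable
on `U`, and `∫ (∂_{j₁} ⋯ ∂_{j_k} φ) u = (-1)ᵏ ∫ φ D_{j₁ … j_k}` for all test functions `φ` on `U`. -/
def IsWeakDeriv {n : ℕ} (U : Set (Rn n)) (k : ℕ) (u : Rn n → Rn n) (D : Rn n → Tensor n k) : Prop :=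
  LocallyIntegrableOn u U ∧ LocallyIntegrableOn D U ∧
    ∀ φ : Rn n → ℝ, IsTestFunction U φ → ∀ J : Fin k → Fin n,
      ∫ x, (iteratedFDeriv ℝ k φ x fun i => EuclideanSpace.single (J i) (1 : ℝ)) • u x
        = (-1 : ℝ) ^ k • ∫ x, φ x • D x J

/-- The value of a first derivative, written as the matrix with entries `∂_j u_i` (row `i`, column `j`). -/
def gradMatrix {n : ℕ} (T : Tensor n 1) : Matrix (Fin n) (Fin n) ℝ :=
  Matrix.of fun i j => T (fun _ => j) i

/-- The Gagliardo integral `∫∫ |f(x) - f(y)|^p / |x - y|^(n + σp) dy dx`. -/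
noncomputable def gagliardo {n k : ℕ} (σ p : ℝ) (f : Rn n → Tensor n k) : ℝ≥0∞ :=
  ∫⁻ x, ∫⁻ y, ‖f x - f y‖ₑ ^ p / edist x y ^ ((n : ℝ) + σ * p)

/-- The Sobolev–Slobodeckij norm of order `t ≥ 0` on `ℝⁿ`, with `t = k + σ`, `k` a natural number and
`0 ≤ σ < 1`: the `p`-th power is the sum of `‖∇ʲu‖_{L^p}^p` for `j ≤ k`, and, if `σ > 0`, of the Gagliardo
integral of `∇ᵏu`. It is `∞` if the weak derivatives up to order `k` do not exist; otherwise these are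
unique up to null sets, so that the infimum is over a single value. -/
noncomputable def sobolevNorm {n : ℕ} (t p : ℝ) (u : Rn n → Rn n) : ℝ≥0∞ :=
  ⨅ (D : ∀ k : ℕ, Rn n → Tensor n k) (_ : ∀ k ≤ ⌊t⌋₊, IsWeakDeriv univ k u (D k)),
    ((∑ k ∈ Finset.range (⌊t⌋₊ + 1), ∫⁻ x, ‖D k x‖ₑ ^ p) +
      if t = (⌊t⌋₊ : ℝ) then 0 else gagliardo (t - ⌊t⌋₊) p (D ⌊t⌋₊)) ^ (1 / p)

/-- `u ∈ W^{t,p}(ℝⁿ)` for a locally integrable `u`, real `t` and `1 < p < ∞`: the Sobolev–Slobodeckij space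
for `t ≥ 0`, and the dual space of `W^{-t,p'}(ℝⁿ)`, `1/p + 1/p' = 1`, for `t < 0` (it is enough to test with
the dense class of smooth compactly supported fields). -/
def MemSobolev {n : ℕ} (t p : ℝ) (u : Rn n → Rn n) : Prop :=
  LocallyIntegrable u ∧
    ((0 ≤ t ∧ sobolevNorm t p u < ∞) ∨
      (t < 0 ∧ ∃ C : ℝ, ∀ ψ : Rn n → Rn n, ContDiff ℝ (⊤ : ℕ∞) ψ → HasCompactSupport ψ →
        ENNReal.ofReal |∫ x, ⟪u x, ψ x⟫| ≤ ENNReal.ofReal C * sobolevNorm (-t) p.conjExponent ψ))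

/-- `Ω` has a boundary of class `C^{1,1}`: near each boundary point, in the direction of a suitable unit
vector `e`, `Ω` is the strict epigraph of a `C^{1,1}` function of the component orthogonal to `e`. -/
def HasC11Boundary {n : ℕ} (Ω : Set (Rn n)) : Prop :=
  ∀ x₀ ∈ frontier Ω, ∃ (r : ℝ) (e : Rn n) (γ : Rn n → ℝ), 0 < r ∧ ‖e‖ = 1 ∧
    ContDiff ℝ 1 γ ∧ (∃ L, LipschitzWith L (fderiv ℝ γ)) ∧
    ∀ x ∈ Metric.ball x₀ r, x ∈ Ω ↔ γ (x - ⟪e, x⟫ • e) < ⟪e, x⟫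

/-- The energy wells at temperature `θ`: `α(θ) SO(n)` above the transformation temperature `θc`, and
the union of the `SO(n) U_j(θ)` at and below it. -/
def wells {n m : ℕ} (θc : ℝ) (α : ℝ → ℝ) (U : Fin m → ℝ → Matrix (Fin n) (Fin n) ℝ) (θ : ℝ) :
    Set (Matrix (Fin n) (Fin n) ℝ) :=
  {A | (θc < θ ∧ ∃ R ∈ Matrix.specialOrthogonalGroup (Fin n) ℝ, A = α θ • R) ∨
    (θ ≤ θc ∧ ∃ j, ∃ R ∈ Matrix.specialOrthogonalGroup (Fin n) ℝ, A = R * U j θ)}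

/-- `E_{ε,p}`: the infimum of `∫_Ω dist²(∇u, K) + ε^p ‖∇²u‖_{L^p(Ω)}^p` over all weakly differentiable
`u : ℝⁿ → ℝⁿ` with `∇u = M` a.e. outside the closure of `Ω` (only those that have a weak second derivative
`H` on `Ω` matter). The distance is the one of the Frobenius norm. -/
noncomputable def energy {n : ℕ} (Ω : Set (Rn n)) (K : Set (Matrix (Fin n) (Fin n) ℝ))
    (M : Matrix (Fin n) (Fin n) ℝ) (p ε : ℝ) : ℝ≥0∞ :=
  ⨅ (u : Rn n → Rn n) (G : Rn n → Tensor n 1) (H : Rn n → Tensor n 2)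
    (_ : IsWeakDeriv univ 1 u G) (_ : IsWeakDeriv Ω 2 u H)
    (_ : ∀ᵐ x ∂volume.restrict (closure Ω)ᶜ, gradMatrix (G x) = M),
    (∫⁻ x in Ω, Metric.infEDist (gradMatrix (G x)) K ^ 2) +
      ENNReal.ofReal (ε ^ p) * ∫⁻ x in Ω, ‖H x‖ₑ ^ p

/-- `∇u ∈ K` a.e. in `Ω` and `∇u = M` a.e. outside the closure of `Ω`. -/
def IsSolution {n : ℕ} (Ω : Set (Rn n)) (K : Set (Matrix (Fin n) (Fin n) ℝ))
    (M : Matrix (Fin n) (Fin n) ℝ) (u : Rn n → Rn n) : Prop :=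
  ∃ G : Rn n → Tensor n 1, IsWeakDeriv univ 1 u G ∧
    (∀ᵐ x ∂volume.restrict Ω, gradMatrix (G x) ∈ K) ∧
    ∀ᵐ x ∂volume.restrict (closure Ω)ᶜ, gradMatrix (G x) = M

/-- `∇v ∈ L^∞(ℝⁿ)`. -/
def HasBoundedGradient {n : ℕ} (v : Rn n → Rn n) : Prop :=
  ∃ G : Rn n → Tensor n 1, IsWeakDeriv univ 1 v G ∧ MemLp G ∞ volume

/-- The shifted map `v(x) = u(x) - Mx - b`. -/
noncomputable def shift {n : ℕ} (M : Matrix (Fin n) (Fin n) ℝ) (b : Rn n) (u : Rn n → Rn n) :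
    Rn n → Rn n :=
  fun x => u x - WithLp.toLp 2 (M *ᵥ x.ofLp) - b

end WellScaling

open WellScaling

/-! Smoothing an exact solution gives a cheap competitor for the energy, so the lower scaling bound
limits how regular an exact solution can be. Suppose `s > 2μ/p` and let `G = ∇v`. Mollify `v` at
scale `ε`, multiply by a cutoff `η` of `Ω`, and add the map `Mx`.

Away from a boundary layer of width of order `ε` the cutoff is inactive. Since `M + G ∈ K`, the
distance to the wells is at most `|ρ_ε * G - G|`; this is bounded and `p ≤ 2`, so its square is
controlled by its `p`-th power. A finite Gagliardo seminorm of `G` gives `‖ρ_ε * G - G‖_p^p ≲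
ε^(sp)` and, because the derivatives of `ρ_ε` have mean zero, `‖∇²(ρ_ε * v)‖_p^p ≲ ε^(sp-p)`. After
the weight `ε^p`, both terms are of order `ε^(sp)`.

The layer has volume `O(ε)`. There `ρ_ε * v = O(ε)`, because it has bounded gradient and vanishes at
a point within distance `O(ε)`. This offsets the derivatives of `η`, so the cutoff costs only
`O(ε)`. Hence `E_ε ≲ ε^(min(1, sp))`, and the lower bound forces `min(1, sp) ≤ 2μ`, impossible since
`2μ < 1` and `2μ < sp`.

If `s ≥ 1`, then `∇²v ∈ L^p`. Mollifying at a scale much finer than `ε` gives `E_ε ≲ ε`, again too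
small.

The argument rests on `thinLayer_frontier` (geometry), `energy_le_of_smooth` (cutoff),
`enorm_conv_sub_rpow_le` (fractional smoothing) and `not_lower_bound_of_upper_bound` (comparison of
exponents). -/

namespace WellScaling

open Filter Topology

/-! ### Coordinate derivatives of smooth maps and their agreement with weak derivatives. -/

section PartialDerivatives

variable {n : ℕ} {F : Type*} [NormedAddCommGroup F] [NormedSpace ℝ F]

/-- The `i`-th standard basis vector. -/
noncomputable abbrev stdVec {n : ℕ} (i : Fin n) : Rn n := EuclideanSpace.single i (1 : ℝ)

/-- The partial derivative in the `i`-th coordinate direction. -/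
noncomputable def pd (i : Fin n) (f : Rn n → F) (x : Rn n) : F := fderiv ℝ f x (stdVec i)

/-- All first partial derivatives of a map. -/
noncomputable def tensor1 (f : Rn n → Rn n) (x : Rn n) : Tensor n 1 :=
  WithLp.toLp 2 fun J => pd (J 0) f x

/-- All second partial derivatives of a map. -/
noncomputable def tensor2 (f : Rn n → Rn n) (x : Rn n) : Tensor n 2 :=
  WithLp.toLp 2 fun J => pd (J 0) (pd (J 1) f) x

theorem contDiff_pd {f : Rn n → F} (hf : ContDiff ℝ (⊤ : ℕ∞) f) (i : Fin n) :
    ContDiff ℝ (⊤ : ℕ∞) (pd i f) := by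
  have : ContDiff ℝ (⊤ : ℕ∞) (fderiv ℝ f) := hf.fderiv_right (by simp)
  exact this.clm_apply contDiff_const

theorem hasCompactSupport_pd {f : Rn n → F} (hf : HasCompactSupport f) (i : Fin n) :
    HasCompactSupport (pd i f) :=
  hf.fderiv_apply ℝ _

theorem tsupport_pd_subset (f : Rn n → F) (i : Fin n) : tsupport (pd i f) ⊆ tsupport f :=
  tsupport_fderiv_apply_subset ℝ _

theorem pd_pd_eq {f : Rn n → F} (hf : ContDiff ℝ (⊤ : ℕ∞) f) (i j : Fin n) (x : Rn n) :
    pd i (pd j f) x = fderiv ℝ (fderiv ℝ f) x (stdVec i) (stdVec j) := by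
  have h : ContDiff ℝ (⊤ : ℕ∞) (fderiv ℝ f) := hf.fderiv_right (by simp)
  have hd : DifferentiableAt ℝ (fderiv ℝ f) x := (h.differentiable (by simp)) x
  unfold pd
  rw [fderiv_clm_apply hd (differentiableAt_const _)]
  simp

theorem pd_smul {η : Rn n → ℝ} {f : Rn n → F} (hη : ContDiff ℝ (⊤ : ℕ∞) η)
    (hf : ContDiff ℝ (⊤ : ℕ∞) f) (i : Fin n) :
    pd i (fun x => η x • f x) = fun x => η x • pd i f x + pd i η x • f x := by
  ext x
  have h1 : DifferentiableAt ℝ η x := (hη.differentiable (by simp)) x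
  have h2 : DifferentiableAt ℝ f x := (hf.differentiable (by simp)) x
  simp [pd, fderiv_fun_smul h1 h2]

theorem pd_add {f g : Rn n → F} (hf : ContDiff ℝ (⊤ : ℕ∞) f)
    (hg : ContDiff ℝ (⊤ : ℕ∞) g) (i : Fin n) :
    pd i (fun x => f x + g x) = fun x => pd i f x + pd i g x := by
  ext x
  have h1 : DifferentiableAt ℝ f x := (hf.differentiable (by simp)) x
  have h2 : DifferentiableAt ℝ g x := (hg.differentiable (by simp)) x
  simp [pd, fderiv_fun_add h1 h2]

theorem pd_congr {f g : Rn n → F} {x : Rn n} (h : f =ᶠ[𝓝 x] g) (i : Fin n) :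
    pd i f =ᶠ[𝓝 x] pd i g := by
  filter_upwards [h.eventuallyEq_nhds] with y hy
  simp [pd, hy.fderiv_eq]

theorem continuous_tensor1 {f : Rn n → Rn n} (hf : ContDiff ℝ (⊤ : ℕ∞) f) :
    Continuous (tensor1 f) :=
  (PiLp.continuous_toLp 2 _).comp (continuous_pi fun _ => (contDiff_pd hf _).continuous)

theorem continuous_tensor2 {f : Rn n → Rn n} (hf : ContDiff ℝ (⊤ : ℕ∞) f) :
    Continuous (tensor2 f) :=
  (PiLp.continuous_toLp 2 _).comp
    (continuous_pi fun _ => (contDiff_pd (contDiff_pd hf _) _).continuous)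

/-- Integration by parts in a coordinate direction. -/
theorem integral_smul_pd {φ : Rn n → ℝ} {f : Rn n → F} (hφ : ContDiff ℝ (⊤ : ℕ∞) φ)
    (hc : HasCompactSupport φ) (hf : ContDiff ℝ (⊤ : ℕ∞) f) (i : Fin n) :
    ∫ x, pd i φ x • f x = -∫ x, φ x • pd i f x := by
  have h := integral_smul_fderiv_eq_neg_fderiv_smul_of_integrable (μ := (volume : Measure (Rn n)))
    (f := φ) (g := f) (v := stdVec i) ?_ ?_ ?_ ?_ ?_
  · unfold pd; rw [h, neg_neg]
  · exact ((contDiff_pd hφ i).continuous.smul hf.continuous).integrable_of_hasCompactSupport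
      ((hasCompactSupport_pd hc i).smul_right)
  · exact (hφ.continuous.smul (contDiff_pd hf i).continuous).integrable_of_hasCompactSupport
      hc.smul_right
  · exact (hφ.continuous.smul hf.continuous).integrable_of_hasCompactSupport hc.smul_right
  · exact fun x _ => (hφ.differentiable (by simp)) x
  · exact fun x _ => (hf.differentiable (by simp)) x

theorem iteratedFDeriv_one_stdVec (φ : Rn n → F) (J : Fin 1 → Fin n) (x : Rn n) :
    (iteratedFDeriv ℝ 1 φ x fun i => EuclideanSpace.single (J i) (1 : ℝ)) = pd (J 0) φ x := by
  simp [pd, iteratedFDeriv_one_apply]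

theorem iteratedFDeriv_two_stdVec {φ : Rn n → F} (hφ : ContDiff ℝ (⊤ : ℕ∞) φ)
    (J : Fin 2 → Fin n) (x : Rn n) :
    (iteratedFDeriv ℝ 2 φ x fun i => EuclideanSpace.single (J i) (1 : ℝ))
      = pd (J 0) (pd (J 1) φ) x := by
  rw [iteratedFDeriv_two_apply, pd_pd_eq hφ]

theorem isWeakDeriv_tensor1 {f : Rn n → Rn n} (hf : ContDiff ℝ (⊤ : ℕ∞) f) (U : Set (Rn n)) :
    IsWeakDeriv U 1 f (tensor1 f) := by
  refine ⟨hf.continuous.locallyIntegrable.locallyIntegrableOn _,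
    (continuous_tensor1 hf).locallyIntegrable.locallyIntegrableOn _, ?_⟩
  rintro φ ⟨hφ, hc, -⟩ J
  simp only [iteratedFDeriv_one_stdVec]
  rw [integral_smul_pd hφ hc hf]
  simp [tensor1]

theorem isWeakDeriv_tensor2 {f : Rn n → Rn n} (hf : ContDiff ℝ (⊤ : ℕ∞) f) (U : Set (Rn n)) :
    IsWeakDeriv U 2 f (tensor2 f) := by
  refine ⟨hf.continuous.locallyIntegrable.locallyIntegrableOn _,
    (continuous_tensor2 hf).locallyIntegrable.locallyIntegrableOn _, ?_⟩
  rintro φ ⟨hφ, hc, -⟩ J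
  simp only [iteratedFDeriv_two_stdVec hφ]
  have hcomm : pd (J 0) (pd (J 1) f) = pd (J 1) (pd (J 0) f) := by
    ext1 x
    rw [pd_pd_eq hf, pd_pd_eq hf]
    exact (hf.contDiffAt.isSymmSndFDerivAt (by simp only [minSmoothness_of_isRCLikeNormedField]; exact ENat.LEInfty.out)).eq _ _
  rw [integral_smul_pd (contDiff_pd hφ _) (hasCompactSupport_pd hc _) hf,
    integral_smul_pd hφ hc (contDiff_pd hf _)]
  simp [tensor2, hcomm]

end PartialDerivatives

/-! ### Norms of derivative tensors and affine maps. -/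

section Tensors

variable {n k : ℕ}

theorem norm_apply_le (T : Tensor n k) (J : Fin k → Fin n) : ‖T J‖ ≤ ‖T‖ := PiLp.norm_apply_le T J

theorem norm_tensor_le {T : Tensor n k} {c : ℝ} (hc : 0 ≤ c) (h : ∀ J, ‖T J‖ ≤ c) :
    ‖T‖ ≤ Fintype.card (Fin k → Fin n) * c := by
  rw [PiLp.norm_eq_of_L2]
  refine (Real.sqrt_le_sqrt (Finset.sum_le_sum fun J _ => pow_le_pow_left₀ (norm_nonneg _) (h J) 2)).trans ?_
  rw [Finset.sum_const, Finset.card_univ, nsmul_eq_mul]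
  refine Real.sqrt_le_iff.mpr ⟨by positivity, ?_⟩
  rw [mul_pow]
  gcongr
  exact_mod_cast Nat.le_self_pow two_ne_zero _

/-- Links the distance to the wells, measured in the Frobenius norm of matrices, with the `L^p`
estimates, which are made for tensors. -/
theorem norm_gradMatrix (T : Tensor n 1) : ‖gradMatrix T‖ = ‖T‖ := by
  rw [PiLp.norm_eq_of_L2, Matrix.frobenius_norm_def, ← Real.sqrt_eq_rpow, Finset.sum_comm]
  congr 1
  rw [← (Equiv.funUnique (Fin 1) (Fin n)).symm.sum_comp]
  refine Finset.sum_congr rfl fun j _ => ?_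
  rw [EuclideanSpace.norm_sq_eq]
  simp only [gradMatrix, Matrix.of_apply, Real.rpow_ofNat]
  rfl

theorem gradMatrix_sub (S T : Tensor n 1) : gradMatrix (S - T) = gradMatrix S - gradMatrix T := by
  ext; simp [gradMatrix]

theorem edist_gradMatrix (S T : Tensor n 1) : edist (gradMatrix S) (gradMatrix T) = ‖S - T‖ₑ := by
  rw [edist_eq_enorm_sub, ← gradMatrix_sub, ← ofReal_norm, ← ofReal_norm, norm_gradMatrix]

/-- The constant gradient of the linear map with matrix `M`. -/
noncomputable def matTensor (M : Matrix (Fin n) (Fin n) ℝ) : Tensor n 1 :=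
  WithLp.toLp 2 fun J => WithLp.toLp 2 fun i => M i (J 0)

theorem gradMatrix_matTensor (M : Matrix (Fin n) (Fin n) ℝ) : gradMatrix (matTensor M) = M := by
  ext; simp [gradMatrix, matTensor]

theorem contDiff_affine (M : Matrix (Fin n) (Fin n) ℝ) (b : Rn n) :
    ContDiff ℝ (⊤ : ℕ∞) fun x : Rn n => WithLp.toLp 2 (M *ᵥ x.ofLp) + b :=
  ((Matrix.toEuclideanCLM (𝕜 := ℝ) M).contDiff (n := (⊤ : ℕ∞))).add contDiff_const

theorem tensor1_affine (M : Matrix (Fin n) (Fin n) ℝ) (b x : Rn n) :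
    tensor1 (fun x : Rn n => WithLp.toLp 2 (M *ᵥ x.ofLp) + b) x = matTensor M := by
  ext J i
  have h : HasFDerivAt (fun x : Rn n => WithLp.toLp 2 (M *ᵥ x.ofLp) + b)
      (Matrix.toEuclideanCLM (𝕜 := ℝ) M : Rn n →L[ℝ] Rn n) x :=
    (Matrix.toEuclideanCLM (𝕜 := ℝ) M : Rn n →L[ℝ] Rn n).hasFDerivAt.add_const b
  simp [tensor1, pd, h.fderiv, matTensor]

theorem norm_fderiv_le_tensor1 (f : Rn n → Rn n) (x : Rn n) :
    ‖fderiv ℝ f x‖ ≤ n * ‖tensor1 f x‖ := by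
  refine ContinuousLinearMap.opNorm_le_bound _ (by positivity) fun h => ?_
  have hh : h = ∑ i, h i • stdVec i := by
    ext j; simp [Finset.sum_apply, Pi.single_apply]
  conv_lhs => rw [hh]
  rw [map_sum]
  refine (norm_sum_le _ _).trans ?_
  have : ∀ i ∈ (Finset.univ : Finset (Fin n)),
      ‖fderiv ℝ f x (h i • stdVec i)‖ ≤ ‖tensor1 f x‖ * ‖h‖ := by
    intro i _
    rw [map_smul, norm_smul, mul_comm]
    exact mul_le_mul (norm_apply_le (tensor1 f x) (fun _ => i)) (PiLp.norm_apply_le h i)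
      (norm_nonneg _) (norm_nonneg _)
  refine (Finset.sum_le_sum this).trans ?_
  simp [mul_assoc]

end Tensors

/-! ### Uniqueness of weak derivatives. -/

section Uniqueness

variable {n k : ℕ}

/-- The solution property, the boundedness of the gradient and the Sobolev regularity each come with
their own representative of the derivative; this lets them be merged. -/
theorem IsWeakDeriv.ae_eq {u : Rn n → Rn n} {D D' : Rn n → Tensor n k}
    (h : IsWeakDeriv univ k u D) (h' : IsWeakDeriv univ k u D') : D =ᵐ[volume] D' := by
  refine ae_eq_of_integral_contDiff_smul_eq (locallyIntegrableOn_univ.1 h.2.1)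
    (locallyIntegrableOn_univ.1 h'.2.1) fun φ hφ hc => ?_
  have hφi : ∀ {E : Rn n → Tensor n k}, IsWeakDeriv univ k u E → Integrable fun x => φ x • E x :=
    fun hE => (locallyIntegrableOn_univ.1 hE.2.1).integrable_smul_left_of_hasCompactSupport
      hφ.continuous hc
  have key : ∀ {E : Rn n → Tensor n k}, IsWeakDeriv univ k u E → ∀ J,
      (∫ x, φ x • E x) J = ∫ x, φ x • E x J := by
    intro E hE J
    exact ((PiLp.proj 2 (𝕜 := ℝ) (fun _ : Fin k → Fin n => Rn n) J).integral_comp_comm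
      (hφi hE)).symm
  ext1 J
  rw [key h, key h']
  have e := (h.2.2 φ ⟨hφ, hc, subset_univ _⟩ J).symm.trans (h'.2.2 φ ⟨hφ, hc, subset_univ _⟩ J)
  exact smul_right_injective _ (pow_ne_zero k (neg_ne_zero.2 (one_ne_zero (α := ℝ)))) e

theorem isWeakDeriv_shift {M : Matrix (Fin n) (Fin n) ℝ} {b : Rn n} {u : Rn n → Rn n}
    {G : Rn n → Tensor n 1} (h : IsWeakDeriv univ 1 u G) :
    IsWeakDeriv univ 1 (shift M b u) fun x => G x - matTensor M := by
  have ha := contDiff_affine M b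
  have ht := isWeakDeriv_tensor1 ha univ
  have e : shift M b u = fun x => u x - (WithLp.toLp 2 (M *ᵥ x.ofLp) + b) := by
    ext x : 1; simp [shift, sub_sub]
  have h1 := locallyIntegrableOn_univ.1 h.1
  have h2 := locallyIntegrableOn_univ.1 h.2.1
  have h3 := locallyIntegrableOn_univ.1 ht.1
  rw [e]
  refine ⟨locallyIntegrableOn_univ.2 (h1.sub h3), locallyIntegrableOn_univ.2 (h2.sub (locallyIntegrable_const _)), ?_⟩
  rintro φ ⟨hφ, hc, hs⟩ J
  have e1 := h.2.2 φ ⟨hφ, hc, hs⟩ J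
  have e2 := ht.2.2 φ ⟨hφ, hc, hs⟩ J
  simp only [iteratedFDeriv_one_stdVec, tensor1_affine] at e1 e2 ⊢
  have hp := (contDiff_pd hφ (J 0)).continuous
  have hpc := hasCompactSupport_pd hc (J 0)
  simp only [smul_sub, PiLp.sub_apply]
  have h2J : LocallyIntegrable fun x => G x J := by
    intro x
    obtain ⟨s, hs, hi⟩ := h2 x
    exact ⟨s, hs, (PiLp.proj 2 (𝕜 := ℝ) (fun _ : Fin 1 → Fin n => Rn n) J).integrable_comp hi⟩
  rw [integral_sub (h1.integrable_smul_left_of_hasCompactSupport hp hpc)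
      (h3.integrable_smul_left_of_hasCompactSupport hp hpc),
    integral_sub (h2J.integrable_smul_left_of_hasCompactSupport hφ.continuous hc)
      ((locallyIntegrable_const _).integrable_smul_left_of_hasCompactSupport hφ.continuous hc),
    smul_sub, e1, e2]

end Uniqueness

/-! ### Convolution with smooth kernels and pointwise `L^p` bounds. -/

section Convolution

variable {n : ℕ} {F : Type*} [NormedAddCommGroup F] [NormedSpace ℝ F]

/-- The convolution of a scalar kernel with a vector-valued map. -/
noncomputable def conv (k : Rn n → ℝ) (f : Rn n → F) (x : Rn n) : F := ∫ y, k (x - y) • f y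

theorem conv_eq_convolution (k : Rn n → ℝ) (f : Rn n → F) :
    conv k f = convolution k f (ContinuousLinearMap.lsmul ℝ ℝ) volume := by
  ext1 x
  rw [convolution_lsmul_swap, conv]

theorem hasCompactSupport_comp_sub {k : Rn n → ℝ} (hc : HasCompactSupport k) (x : Rn n) :
    HasCompactSupport fun y => k (x - y) :=
  hc.comp_homeomorph (Homeomorph.subLeft x)

theorem integrable_conv {k : Rn n → ℝ} {f : Rn n → F} (hk : Continuous k)
    (hc : HasCompactSupport k) (hf : LocallyIntegrable f) (x : Rn n) :
    Integrable fun y => k (x - y) • f y :=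
  hf.integrable_smul_left_of_hasCompactSupport (by fun_prop) (hasCompactSupport_comp_sub hc x)

theorem contDiff_conv {k : Rn n → ℝ} {f : Rn n → F} (hk : ContDiff ℝ (⊤ : ℕ∞) k)
    (hc : HasCompactSupport k) (hf : LocallyIntegrable f) : ContDiff ℝ (⊤ : ℕ∞) (conv k f) := by
  rw [conv_eq_convolution]
  exact hc.contDiff_convolution_left _ hk hf

theorem pd_conv {k : Rn n → ℝ} {f : Rn n → F} (hk : ContDiff ℝ (⊤ : ℕ∞) k)
    (hc : HasCompactSupport k) (hf : LocallyIntegrable f) (i : Fin n) :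
    pd i (conv k f) = conv (pd i k) f := by
  ext1 x
  have hk1 : ContDiff ℝ 1 k := hk.of_le (by simp)
  have h := hc.hasFDerivAt_convolution_left (ContinuousLinearMap.lsmul ℝ ℝ) hk1 hf x
  rw [← conv_eq_convolution] at h
  rw [pd, h.fderiv, convolution_eq_swap, ContinuousLinearMap.integral_apply]
  · simp [conv, pd]
  · exact ((hc.fderiv ℝ).convolutionExists_left
      (ContinuousLinearMap.precompL (Rn n) (ContinuousLinearMap.lsmul ℝ ℝ : ℝ →L[ℝ] F →L[ℝ] F))
      (hk1.continuous_fderiv one_ne_zero) hf x).integrable_swap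

theorem pd_comp_sub {k : Rn n → ℝ} (hk : ContDiff ℝ (⊤ : ℕ∞) k) (i : Fin n) (x : Rn n) :
    pd i (fun y => k (x - y)) = fun y => -pd i k (x - y) := by
  ext1 y
  have h : HasFDerivAt k (fderiv ℝ k (x - y)) (x - y) :=
    ((hk.differentiable (by simp)) _).hasFDerivAt
  have h2 : HasFDerivAt (fun y : Rn n => x - y) (-ContinuousLinearMap.id ℝ (Rn n)) y :=
    (hasFDerivAt_id y).const_sub x
  have h3 := h.comp y h2
  simp only [Function.comp_def] at h3
  rw [pd, h3.fderiv]
  simp [pd]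

theorem isTestFunction_comp_sub {k : Rn n → ℝ} (hk : ContDiff ℝ (⊤ : ℕ∞) k)
    (hc : HasCompactSupport k) (x : Rn n) : IsTestFunction univ fun y => k (x - y) :=
  ⟨hk.comp (contDiff_const.sub contDiff_id), hasCompactSupport_comp_sub hc x, subset_univ _⟩

theorem conv_apply {m : ℕ} {k : Rn n → ℝ} {G : Rn n → Tensor n m} (hk : Continuous k)
    (hc : HasCompactSupport k) (hG : LocallyIntegrable G) (x : Rn n) (J : Fin m → Fin n) :
    conv k G x J = ∫ y, k (x - y) • G y J :=
  ((PiLp.proj 2 (𝕜 := ℝ) (fun _ : Fin m → Fin n => Rn n) J).integral_comp_comm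
    (integrable_conv hk hc hG x)).symm

/-- Take `y ↦ k (x - y)` as test function: the sign from the reflection cancels the one in the
definition of the weak derivative. -/
theorem conv_pd_eq {k : Rn n → ℝ} {v : Rn n → Rn n} {G : Rn n → Tensor n 1}
    (hk : ContDiff ℝ (⊤ : ℕ∞) k) (hc : HasCompactSupport k) (hv : IsWeakDeriv univ 1 v G)
    (J : Fin 1 → Fin n) (x : Rn n) : conv (pd (J 0) k) v x = conv k G x J := by
  have h := hv.2.2 _ (isTestFunction_comp_sub hk hc x) J
  simp only [iteratedFDeriv_one_stdVec, pd_comp_sub hk] at h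
  rw [conv_apply hk.continuous hc (locallyIntegrableOn_univ.1 hv.2.1)]
  simpa [integral_neg, conv] using h

theorem conv_pd_pd_eq {k : Rn n → ℝ} {v : Rn n → Rn n} {D : Rn n → Tensor n 2}
    (hk : ContDiff ℝ (⊤ : ℕ∞) k) (hc : HasCompactSupport k) (hv : IsWeakDeriv univ 2 v D)
    (J : Fin 2 → Fin n) (x : Rn n) : conv (pd (J 0) (pd (J 1) k)) v x = conv k D x J := by
  have ht := isTestFunction_comp_sub hk hc x
  have h := hv.2.2 _ ht J
  have e : pd (J 0) (pd (J 1) fun y => k (x - y)) = fun y => pd (J 0) (pd (J 1) k) (x - y) := by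
    rw [pd_comp_sub hk]
    have h1 := pd_comp_sub (contDiff_pd hk (J 1)) (J 0) x
    ext1 y
    have := congrFun h1 y
    simp only [pd, fderiv_fun_neg] at this ⊢
    simp [this]
  simp only [iteratedFDeriv_two_stdVec ht.1, e] at h
  rw [conv_apply hk.continuous hc (locallyIntegrableOn_univ.1 hv.2.1)]
  simpa [conv] using h

theorem tensor1_conv {k : Rn n → ℝ} {v : Rn n → Rn n} {G : Rn n → Tensor n 1}
    (hk : ContDiff ℝ (⊤ : ℕ∞) k) (hc : HasCompactSupport k) (hv : IsWeakDeriv univ 1 v G) :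
    tensor1 (conv k v) = conv k G := by
  ext x J : 2
  rw [← conv_pd_eq hk hc hv, ← pd_conv hk hc (locallyIntegrableOn_univ.1 hv.1)]
  rfl

theorem tensor2_conv {k : Rn n → ℝ} {v : Rn n → Rn n} {D : Rn n → Tensor n 2}
    (hk : ContDiff ℝ (⊤ : ℕ∞) k) (hc : HasCompactSupport k) (hv : IsWeakDeriv univ 2 v D) :
    tensor2 (conv k v) = conv k D := by
  have hl := locallyIntegrableOn_univ.1 hv.1
  ext x J : 2
  rw [← conv_pd_pd_eq hk hc hv, ← pd_conv (contDiff_pd hk _) (hasCompactSupport_pd hc _) hl,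
    ← pd_conv hk hc hl]
  rfl

/-- One derivative falls on `v` and the other on the kernel, so second derivatives of the mollified
map need only a first weak derivative of `v`. -/
theorem tensor2_conv_apply {k : Rn n → ℝ} {v : Rn n → Rn n} {G : Rn n → Tensor n 1}
    (hk : ContDiff ℝ (⊤ : ℕ∞) k) (hc : HasCompactSupport k) (hv : IsWeakDeriv univ 1 v G)
    (x : Rn n) (J : Fin 2 → Fin n) :
    tensor2 (conv k v) x J = conv (pd (J 1) k) G x fun _ => J 0 := by
  have hl := locallyIntegrableOn_univ.1 hv.1
  rw [← conv_pd_eq (contDiff_pd hk _) (hasCompactSupport_pd hc _) hv,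
    ← pd_conv (contDiff_pd hk _) (hasCompactSupport_pd hc _) hl, ← pd_conv hk hc hl]
  rfl

theorem conv_const [CompleteSpace F] (k : Rn n → ℝ) (c : F) (x : Rn n) :
    conv k (fun _ => c) x = (∫ y, k y) • c := by
  rw [conv, integral_smul_const, integral_sub_left_eq_self]

/-- The derivative of a compactly supported kernel has mean zero. This allows `G x` to be subtracted
from `G` inside the convolution. -/
theorem conv_pd_const [CompleteSpace F] {k : Rn n → ℝ} (hk : ContDiff ℝ (⊤ : ℕ∞) k)
    (hc : HasCompactSupport k) (i : Fin n) (c : F) (x : Rn n) :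
    conv (pd i k) (fun _ => c) x = 0 := by
  rw [← pd_conv hk hc (locallyIntegrable_const c), funext (conv_const k c)]
  simp [pd]

theorem conv_sub_const [CompleteSpace F] {k : Rn n → ℝ} {f : Rn n → F} (hk : Continuous k)
    (hc : HasCompactSupport k) (hf : LocallyIntegrable f) (c : F) (x : Rn n) :
    conv k (fun y => f y - c) x = conv k f x - conv k (fun _ => c) x := by
  simp only [conv, smul_sub]
  exact integral_sub (integrable_conv hk hc hf x)
    (integrable_conv hk hc (locallyIntegrable_const c) x)

theorem enorm_conv_le {k : Rn n → ℝ} {A δ : ℝ} (hA : ∀ z, ‖k z‖ ≤ A)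
    (hδ : ∀ z, δ < ‖z‖ → k z = 0) (f : Rn n → F) (x : Rn n) :
    ‖conv k f x‖ₑ ≤ ENNReal.ofReal A * ∫⁻ y in Metric.closedBall x δ, ‖f y‖ₑ := by
  refine (enorm_integral_le_lintegral_enorm _).trans ?_
  rw [← lintegral_const_mul' _ _ ENNReal.ofReal_ne_top, ← lintegral_indicator measurableSet_closedBall]
  refine lintegral_mono fun y => ?_
  by_cases hy : y ∈ Metric.closedBall x δ
  · rw [indicator_of_mem hy, enorm_smul]
    gcongr
    rw [← ofReal_norm]
    exact ENNReal.ofReal_le_ofReal (hA _)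
  · rw [indicator_of_notMem hy, hδ (x - y)]
    · simp
    · rw [Metric.mem_closedBall, dist_comm, dist_eq_norm] at hy
      exact not_le.1 hy

/-- Hölder's inequality against the constant function `1`. -/
theorem rpow_lintegral_le {α : Type*} [MeasurableSpace α] (ν : Measure α) {p : ℝ} (hp : 1 < p)
    {f : α → ℝ≥0∞} (hf : AEMeasurable f ν) :
    (∫⁻ y, f y ∂ν) ^ p ≤ ν univ ^ (p - 1) * ∫⁻ y, f y ^ p ∂ν := by
  have hpq := Real.HolderConjugate.conjExponent hp
  have h := ENNReal.lintegral_mul_le_Lp_mul_Lq ν hpq hf (aemeasurable_const (b := (1 : ℝ≥0∞)))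
  simp only [Pi.mul_apply, mul_one, ENNReal.one_rpow, lintegral_const, one_mul] at h
  refine (ENNReal.rpow_le_rpow h (by linarith)).trans ?_
  rw [ENNReal.mul_rpow_of_nonneg _ _ (by linarith), ← ENNReal.rpow_mul, ← ENNReal.rpow_mul,
    one_div_mul_cancel (by linarith), ENNReal.rpow_one, mul_comm]
  refine le_of_eq (congrArg₂ _ (congrArg _ ?_) rfl)
  rw [div_mul_eq_mul_div, one_mul, div_eq_iff hpq.symm.ne_zero]
  exact hpq.sub_one_mul_conj.symm

theorem enorm_conv_rpow_le {p : ℝ} (hp : 1 < p) {k : Rn n → ℝ} {A δ : ℝ} (hA : ∀ z, ‖k z‖ ≤ A)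
    (hδ : ∀ z, δ < ‖z‖ → k z = 0) {f : Rn n → F} (hf : AEStronglyMeasurable f) (x : Rn n) :
    ‖conv k f x‖ₑ ^ p ≤ ENNReal.ofReal A ^ p * (volume (Metric.closedBall x δ) ^ (p - 1) *
      ∫⁻ y in Metric.closedBall x δ, ‖f y‖ₑ ^ p) := by
  refine (ENNReal.rpow_le_rpow (enorm_conv_le hA hδ f x) (by linarith)).trans ?_
  rw [ENNReal.mul_rpow_of_nonneg _ _ (by linarith)]
  gcongr
  refine (rpow_lintegral_le _ hp hf.enorm.restrict).trans ?_
  rw [Measure.restrict_apply_univ]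

/-- The volume of the unit ball. -/
noncomputable def unitVol (n : ℕ) : ℝ := volume.real (Metric.ball (0 : Rn n) 1)

theorem volume_closedBall_eq (x : Rn n) {δ : ℝ} (hδ : 0 ≤ δ) :
    volume (Metric.closedBall x δ) = ENNReal.ofReal (δ ^ n * unitVol n) := by
  rw [Measure.addHaar_closedBall _ _ hδ, ENNReal.ofReal_mul (by positivity), unitVol,
    ofReal_measureReal measure_ball_lt_top.ne]
  simp

/-- Here `m` counts the derivatives on the kernel. The power of `δ` is `-(n + m)p` from the kernel
bound plus `n(p - 1)` from the volume of the ball. -/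
theorem enorm_conv_rpow_le_of_scaled {p : ℝ} (hp : 1 < p) {k : Rn n → ℝ} {B δ : ℝ} {m : ℕ}
    (hB : 0 ≤ B) (hδ0 : 0 < δ) (hA : ∀ z, ‖k z‖ ≤ B / δ ^ (n + m))
    (hδ : ∀ z, δ < ‖z‖ → k z = 0) {f : Rn n → F} (hf : AEStronglyMeasurable f) (x : Rn n) :
    ‖conv k f x‖ₑ ^ p ≤ ENNReal.ofReal (B ^ p * unitVol n ^ (p - 1) * δ ^ (-(n + m * p))) *
      ∫⁻ y in Metric.closedBall x δ, ‖f y‖ₑ ^ p := by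
  refine (enorm_conv_rpow_le hp hA hδ hf x).trans ?_
  have hu : 0 ≤ unitVol n := measureReal_nonneg
  rw [← mul_assoc]
  gcongr
  rw [volume_closedBall_eq x hδ0.le, ENNReal.ofReal_rpow_of_nonneg (by positivity) (by linarith),
    ENNReal.ofReal_rpow_of_nonneg (by positivity) (by linarith),
    ← ENNReal.ofReal_mul (by positivity)]
  refine ENNReal.ofReal_le_ofReal (le_of_eq ?_)
  rw [Real.div_rpow hB (by positivity), Real.mul_rpow (by positivity) hu,
    ← Real.rpow_natCast, ← Real.rpow_natCast, ← Real.rpow_mul hδ0.le, ← Real.rpow_mul hδ0.le,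
    div_eq_mul_inv, ← Real.rpow_neg hδ0.le]
  have : δ ^ (-(n + m * p)) = δ ^ (-(((n + m : ℕ) : ℝ) * p)) * δ ^ ((n : ℝ) * (p - 1)) := by
    rw [← Real.rpow_add hδ0]; congr 1; push_cast; ring
  rw [this]; ring

end Convolution

/-! ### Mollifiers with derivative bounds uniform in the scale. -/

section Mollifiers

variable {n : ℕ}

/-- A mollifier at scale `δ`, with the constant `B` in the bounds on its derivatives. -/
structure IsMollifier (B δ : ℝ) (ρ : Rn n → ℝ) : Prop where
  contDiff : ContDiff ℝ (⊤ : ℕ∞) ρ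
  eq_zero : ∀ z, δ ≤ ‖z‖ → ρ z = 0
  nonneg : ∀ z, 0 ≤ ρ z
  integral_eq : ∫ z, ρ z = 1
  bound : ∀ z, ‖ρ z‖ ≤ B / δ ^ (n + 0)
  bound_pd : ∀ i z, ‖pd i ρ z‖ ≤ B / δ ^ (n + 1)
  bound_pd_pd : ∀ i j z, ‖pd i (pd j ρ) z‖ ≤ B / δ ^ (n + 2)

theorem pd_comp_smul {F : Type*} [NormedAddCommGroup F] [NormedSpace ℝ F] (f : Rn n → F) (a c : ℝ)
    (i : Fin n) : pd i (fun x => a • f (c • x)) = fun x => (a * c) • pd i f (c • x) := by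
  ext1 x
  have : (fun x => a • f (c • x)) = a • fun x => f (c • x) := rfl
  rw [pd, this, fderiv_const_smul_field, Pi.smul_apply, fderiv_comp_smul]
  simp [pd, mul_smul]

/-- Rescaling one fixed bump supplies every scale; each derivative costs a factor `δ⁻¹`, and a
single `B` dominates all the bounds at scale one. -/
theorem exists_isMollifier (n : ℕ) :
    ∃ B : ℝ, 0 ≤ B ∧ ∀ δ : ℝ, 0 < δ → ∃ ρ : Rn n → ℝ, IsMollifier B δ ρ := by
  let φ : ContDiffBump (0 : Rn n) := ⟨1 / 2, 1, by norm_num, by norm_num⟩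
  let r : Rn n → ℝ := φ.normed volume
  have hr : ContDiff ℝ (⊤ : ℕ∞) r := φ.contDiff_normed
  have hc : HasCompactSupport r := φ.hasCompactSupport_normed
  have hsupp : ∀ z, 1 ≤ ‖z‖ → r z = 0 := by
    intro z hz
    by_contra h
    have : z ∈ Function.support (φ.normed volume) := h
    rw [φ.support_normed_eq] at this
    simp [φ] at this
    linarith
  obtain ⟨B0, h0⟩ := hc.exists_bound_of_continuous hr.continuous
  choose B1 h1 using fun i =>
    (hasCompactSupport_pd hc i).exists_bound_of_continuous (contDiff_pd hr i).continuous
  choose B2 h2 using fun i j => (hasCompactSupport_pd (hasCompactSupport_pd hc j) i).exists_bound_of_continuous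
    (contDiff_pd (contDiff_pd hr j) i).continuous
  have hB0 : 0 ≤ B0 := (norm_nonneg _).trans (h0 0)
  have hB1 : ∀ i, 0 ≤ B1 i := fun i => (norm_nonneg _).trans (h1 i 0)
  have hB2 : ∀ i j, 0 ≤ B2 i j := fun i j => (norm_nonneg _).trans (h2 i j 0)
  have hs1 : 0 ≤ ∑ i, B1 i := Finset.sum_nonneg fun i _ => hB1 i
  have hs2 : 0 ≤ ∑ i, ∑ j, B2 i j := Finset.sum_nonneg fun i _ => Finset.sum_nonneg fun j _ => hB2 i j
  refine ⟨B0 + ∑ i, B1 i + ∑ i, ∑ j, B2 i j, by positivity, fun δ hδ => ?_⟩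
  have hpos : ∀ m : ℕ, (0 : ℝ) ≤ (δ ^ m)⁻¹ := fun m => by positivity
  have key : ∀ (m : ℕ) (t b : ℝ), |t| ≤ b → b ≤ B0 + ∑ i, B1 i + ∑ i, ∑ j, B2 i j →
      |(δ ^ m)⁻¹ * t| ≤ (B0 + ∑ i, B1 i + ∑ i, ∑ j, B2 i j) / δ ^ m := by
    intro m t b ht hb
    rw [abs_mul, abs_of_nonneg (hpos m), div_eq_inv_mul]
    exact mul_le_mul_of_nonneg_left (ht.trans hb) (hpos m)
  have e1 : ∀ i, pd i (fun x => (δ ^ n)⁻¹ • r (δ⁻¹ • x))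
      = fun x => (δ ^ (n + 1))⁻¹ • pd i r (δ⁻¹ • x) := fun i => by
    rw [pd_comp_smul]; simp only [pow_succ, mul_inv]
  have e2 : ∀ i j, pd i (pd j fun x => (δ ^ n)⁻¹ • r (δ⁻¹ • x))
      = fun x => (δ ^ (n + 2))⁻¹ • pd i (pd j r) (δ⁻¹ • x) := fun i j => by
    rw [e1, pd_comp_smul]; simp only [pow_succ, mul_inv]
  refine ⟨fun x => (δ ^ n)⁻¹ • r (δ⁻¹ • x), ?_, ?_, ?_, ?_, ?_, ?_, ?_⟩
  · exact (hr.comp (contDiff_id.const_smul δ⁻¹)).const_smul _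
  · intro z hz
    rw [hsupp, smul_zero]
    rw [norm_smul, norm_inv, Real.norm_of_nonneg hδ.le, ← div_eq_inv_mul, le_div_iff₀ hδ]
    simpa using hz
  · exact fun z => mul_nonneg (hpos n) (φ.nonneg_normed _)
  · rw [integral_smul, Measure.integral_comp_inv_smul volume r δ]
    have : ∫ x, r x = 1 := φ.integral_normed
    rw [this, abs_of_pos (by positivity)]
    simp [hδ.ne']
  · intro z
    exact key _ _ _ (h0 _) (by linarith)
  · intro i z
    rw [e1]
    refine key _ _ _ (h1 i _) ?_
    have := Finset.single_le_sum (fun i _ => hB1 i) (Finset.mem_univ i)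
    linarith
  · intro i j z
    rw [e2]
    refine key _ _ _ (h2 i j _) ?_
    have := Finset.single_le_sum (fun j _ => hB2 i j) (Finset.mem_univ j)
    have := Finset.single_le_sum (f := fun i => ∑ j, B2 i j)
      (fun i _ => Finset.sum_nonneg fun j _ => hB2 i j) (Finset.mem_univ i)
    linarith

namespace IsMollifier

variable {B δ : ℝ} {ρ : Rn n → ℝ} {F : Type*} [NormedAddCommGroup F] [NormedSpace ℝ F]

theorem tsupport_subset (h : IsMollifier B δ ρ) : tsupport ρ ⊆ Metric.closedBall 0 δ := by
  refine closure_minimal (fun z hz => ?_) Metric.isClosed_closedBall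
  by_contra hc
  rw [mem_closedBall_zero_iff, not_le] at hc
  exact hz (h.eq_zero z hc.le)

theorem hasCompactSupport (h : IsMollifier B δ ρ) : HasCompactSupport ρ :=
  HasCompactSupport.of_support_subset_isCompact (isCompact_closedBall 0 δ)
    ((subset_tsupport ρ).trans h.tsupport_subset)

/-- A zero of the nonnegative `ρ` is a minimum, which settles the sphere `‖z‖ = δ` as well. -/
theorem pd_eq_zero (h : IsMollifier B δ ρ) (i : Fin n) (z : Rn n) (hz : δ ≤ ‖z‖) :
    pd i ρ z = 0 := by
  have hmin : IsLocalMin ρ z := by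
    filter_upwards with y
    rw [h.eq_zero z hz]
    exact h.nonneg y
  rw [pd, hmin.fderiv_eq_zero]
  simp

theorem pd_pd_eq_zero (h : IsMollifier B δ ρ) (i j : Fin n) (z : Rn n) (hz : δ < ‖z‖) :
    pd i (pd j ρ) z = 0 := by
  have : z ∉ tsupport (pd i (pd j ρ)) := fun hm => by
    have := h.tsupport_subset (tsupport_pd_subset _ _ (tsupport_pd_subset _ _ hm))
    rw [mem_closedBall_zero_iff] at this
    linarith
  exact image_eq_zero_of_notMem_tsupport this

theorem integrable (h : IsMollifier B δ ρ) : Integrable ρ :=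
  h.contDiff.continuous.integrable_of_hasCompactSupport h.hasCompactSupport

theorem norm_conv_le (h : IsMollifier B δ ρ) {f : Rn n → F} {L : ℝ} (hf : ∀ᵐ x, ‖f x‖ ≤ L)
    (x : Rn n) : ‖conv ρ f x‖ ≤ L := by
  have : ∫ y, ρ (x - y) * L = L := by
    rw [integral_mul_const, integral_sub_left_eq_self ρ, h.integral_eq, one_mul]
  rw [← this]
  refine norm_integral_le_of_norm_le ((h.integrable.comp_sub_left x).mul_const L) ?_
  filter_upwards [hf] with y hy
  rw [norm_smul, Real.norm_of_nonneg (h.nonneg _)]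
  exact mul_le_mul_of_nonneg_left hy (h.nonneg _)

theorem conv_sub [CompleteSpace F] (h : IsMollifier B δ ρ) {f : Rn n → F}
    (hf : LocallyIntegrable f) (c : F) (x : Rn n) :
    conv ρ f x - c = conv ρ (fun y => f y - c) x := by
  rw [conv_sub_const h.contDiff.continuous h.hasCompactSupport hf, conv_const, h.integral_eq,
    one_smul]

theorem conv_eq_zero (h : IsMollifier B δ ρ) {f : Rn n → F} {x : Rn n}
    (hf : ∀ᵐ y, y ∈ Metric.ball x δ → f y = 0) : conv ρ f x = 0 := by
  refine integral_eq_zero_of_ae ?_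
  filter_upwards [hf] with y hy
  by_cases hb : y ∈ Metric.ball x δ
  · simp [hy hb]
  · rw [Metric.mem_ball, dist_comm, dist_eq_norm, not_lt] at hb
    simp [h.eq_zero _ hb]

end IsMollifier

end Mollifiers

/-! ### Volume of the boundary layer and exterior balls near it. -/

section Geometry

variable {n : ℕ}

/-- A strip between two level sets of a function increasing at unit speed in the direction `e` has
volume proportional to its width. -/
theorem volume_strip_le {h : Rn n → ℝ} (hm : Measurable h) {e : Rn n} (he : ‖e‖ = 1)
    (hshift : ∀ x t, h (x - t • e) = h x - t) (x₀ : Rn n) {r c : ℝ} (hc : 0 < c)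
    (hcr : c ≤ r / 2) :
    volume (Metric.ball x₀ r ∩ h ⁻¹' Ioc 0 c)
      ≤ ENNReal.ofReal (2 * volume.real (Metric.ball x₀ (2 * r)) / r * c) := by
  have hr : 0 < r := by linarith
  set S := Metric.ball x₀ r ∩ h ⁻¹' Ioc 0 c with hS
  have hSm : MeasurableSet S := measurableSet_ball.inter (hm measurableSet_Ioc)
  -- The translates of the strip by `k c e`, `k < N`, are disjoint, have equal volume and stay in
  -- the ball of radius `2r`, so the strip has at most `1/N` of the volume of that ball.
  set N := ⌊r / c⌋₊ with hN
  let A : ℕ → Set (Rn n) := fun k => (fun x => x + (-((k * c) • e))) ⁻¹' S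
  have hAvol : ∀ k, volume (A k) = volume S := fun k => measure_preimage_add_right volume _ S
  have hAm : ∀ k, MeasurableSet (A k) := fun k => measurable_add_const _ hSm
  have hAh : ∀ k, ∀ x ∈ A k, k * c < h x ∧ h x ≤ k * c + c := by
    intro k x hx
    have h1 := hx.2
    simp only [mem_preimage, ← sub_eq_add_neg, hshift, mem_Ioc] at h1
    constructor <;> linarith [h1.1, h1.2]
  have hdisj : PairwiseDisjoint (↑(Finset.range N)) A := by
    have key : ∀ j k : ℕ, j < k → Disjoint (A j) (A k) := by
      intro j k hjk
      refine disjoint_left.2 fun x hj hk => ?_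
      have h1 := (hAh j x hj).2
      have h2 := (hAh k x hk).1
      have h3 : (j : ℝ) + 1 ≤ k := by exact_mod_cast hjk
      nlinarith
    intro j _ k _ hjk
    rcases lt_or_gt_of_ne hjk with h1 | h1
    · exact key j k h1
    · exact (key k j h1).symm
  have hsub : ⋃ k ∈ Finset.range N, A k ⊆ Metric.ball x₀ (2 * r) := by
    refine iUnion₂_subset fun k hk x hx => ?_
    have h1 : dist (x + -((k * c) • e)) x₀ < r := hx.1
    have h2 : (k : ℝ) * c ≤ r := by
      have : (k : ℝ) ≤ N := by exact_mod_cast (Finset.mem_range.1 hk).le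
      have h3 : (N : ℝ) ≤ r / c := Nat.floor_le (by positivity)
      rw [le_div_iff₀ hc] at h3
      nlinarith
    have h3 : dist x (x + -((k * c) • e)) ≤ r := by
      rw [dist_eq_norm]
      simpa [norm_smul, he, abs_of_pos hc] using h2
    have := dist_triangle x (x + -((k * c) • e)) x₀
    rw [Metric.mem_ball]
    linarith
  have hsum : (N : ℝ≥0∞) * volume S ≤ volume (Metric.ball x₀ (2 * r)) := by
    refine le_trans (le_of_eq ?_) (measure_mono hsub)
    rw [measure_biUnion_finset hdisj fun k _ => hAm k]
    simp [hAvol]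
  have hfin : volume S ≠ ∞ := ((measure_mono inter_subset_left).trans_lt measure_ball_lt_top).ne
  have hreal : N * volume.real S ≤ volume.real (Metric.ball x₀ (2 * r)) := by
    have := ENNReal.toReal_mono measure_ball_lt_top.ne hsum
    simpa [Measure.real] using this
  rw [← ofReal_measureReal hfin]
  refine ENNReal.ofReal_le_ofReal ?_
  have hN1 : r / c - 1 < N := by linarith [Nat.lt_floor_add_one (r / c)]
  -- The assumption `c ≤ r / 2` means that rounding down loses at most half of `r / c`.
  have hN2 : r / c / 2 ≤ N := by
    have : 2 ≤ r / c := by rw [le_div_iff₀ hc]; linarith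
    linarith
  have h4 : r / c / 2 * volume.real S ≤ volume.real (Metric.ball x₀ (2 * r)) :=
    (mul_le_mul_of_nonneg_right hN2 measureReal_nonneg).trans hreal
  have h5 : volume.real S = r / c / 2 * volume.real S * (2 * c / r) := by field_simp
  rw [h5]
  calc _ ≤ volume.real (Metric.ball x₀ (2 * r)) * (2 * c / r) := by gcongr
    _ = _ := by ring

/-- The points of `Ω` at distance at most `t` from the set `S`. -/
def layer (Ω S : Set (Rn n)) (t : ℝ) : Set (Rn n) := {x ∈ Ω | ∃ z ∈ S, dist x z ≤ t}

/-- The part of `Ω` near `S` has small volume, and each of its points is close to a ball outside `Ω`. -/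
def ThinLayer (Ω S : Set (Rn n)) : Prop :=
  ∃ C t₀ : ℝ, 0 ≤ C ∧ 0 < t₀ ∧ ∀ t, 0 < t → t < t₀ →
    volume (layer Ω S t) ≤ ENNReal.ofReal (C * t) ∧
    ∀ x ∈ layer Ω S t, ∃ y, dist x y ≤ C * t ∧ Disjoint (Metric.ball y t) Ω

theorem thinLayer_empty (Ω : Set (Rn n)) : ThinLayer Ω ∅ :=
  ⟨0, 1, le_rfl, one_pos, fun t _ _ => by simp [layer]⟩

theorem ThinLayer.mono {Ω S T : Set (Rn n)} (hST : S ⊆ T) (h : ThinLayer Ω T) : ThinLayer Ω S := by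
  obtain ⟨C, t₀, hC, ht, H⟩ := h
  have hsub : ∀ t, layer Ω S t ⊆ layer Ω T t := fun t x ⟨h1, z, hz, h2⟩ => ⟨h1, z, hST hz, h2⟩
  exact ⟨C, t₀, hC, ht, fun t h0 h1 => ⟨(measure_mono (hsub t)).trans (H t h0 h1).1,
    fun x hx => (H t h0 h1).2 x (hsub t hx)⟩⟩

theorem ThinLayer.union {Ω S T : Set (Rn n)} (hS : ThinLayer Ω S) (hT : ThinLayer Ω T) :
    ThinLayer Ω (S ∪ T) := by
  obtain ⟨C, t₀, hC, ht, H⟩ := hS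
  obtain ⟨C', t₀', hC', ht', H'⟩ := hT
  refine ⟨C + C', min t₀ t₀', by positivity, lt_min ht ht', fun t h0 h1 => ?_⟩
  obtain ⟨a, b⟩ := H t h0 (h1.trans_le (min_le_left _ _))
  obtain ⟨a', b'⟩ := H' t h0 (h1.trans_le (min_le_right _ _))
  have hsub : layer Ω (S ∪ T) t ⊆ layer Ω S t ∪ layer Ω T t := by
    rintro x ⟨h1, z, hz | hz, h2⟩
    · exact .inl ⟨h1, z, hz, h2⟩
    · exact .inr ⟨h1, z, hz, h2⟩
  have e1 : C * t ≤ (C + C') * t := by nlinarith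
  have e2 : C' * t ≤ (C + C') * t := by nlinarith
  refine ⟨?_, fun x hx => ?_⟩
  · refine (measure_mono hsub).trans ((measure_union_le _ _).trans ((add_le_add a a').trans ?_))
    rw [← ENNReal.ofReal_add (by positivity) (by positivity), ← add_mul]
  · rcases hsub hx with h | h
    · obtain ⟨y, h1, h2⟩ := b x h
      exact ⟨y, h1.trans e1, h2⟩
    · obtain ⟨y, h1, h2⟩ := b' x h
      exact ⟨y, h1.trans e2, h2⟩

/-- The height `h` above the graph is Lipschitz with constant `Λ`, increases at unit speed along
`e`, and is positive exactly on `Ω` near `x₀`. Layer points satisfy `0 < h ≤ Λt`, a strip of small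
volume. Moving down by `3Λt` gives `h ≤ -2Λt`, so `h` stays negative on the ball of radius `t` about
the new point. -/
theorem thinLayer_of_epigraph {Ω : Set (Rn n)} (hΩ : IsOpen Ω) {x₀ : Rn n} {r : ℝ} {e : Rn n}
    {γ : Rn n → ℝ} (hr : 0 < r) (he : ‖e‖ = 1) (hγ : ContDiff ℝ 1 γ)
    (hL : ∃ L, LipschitzWith L (fderiv ℝ γ))
    (hx : ∀ x ∈ Metric.ball x₀ r, x ∈ Ω ↔ γ (x - ⟪e, x⟫ • e) < ⟪e, x⟫) :
    ThinLayer Ω (frontier Ω ∩ Metric.ball x₀ (r / 4)) := by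
  obtain ⟨L, hL⟩ := hL
  set h : Rn n → ℝ := fun x => ⟪e, x⟫ - γ (x - ⟪e, x⟫ • e) with hh
  have hhc : Continuous h := by
    have := hγ.continuous
    fun_prop
  have hee : ⟪e, e⟫ = 1 := by rw [real_inner_self_eq_norm_sq, he]; norm_num
  have hshift : ∀ x t, h (x - t • e) = h x - t := by
    intro x t
    simp only [hh, inner_sub_right, inner_smul_right, hee, mul_one, sub_smul]
    rw [show x - t • e - (⟪e, x⟫ • e - t • e) = x - ⟪e, x⟫ • e by abel]
    ring
  have hinner : ∀ x, |⟪e, x⟫| ≤ ‖x‖ := fun x => by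
    simpa [he] using abs_real_inner_le_norm e x
  have hproj : ∀ x, ‖x - ⟪e, x⟫ • e‖ ≤ 2 * ‖x‖ := fun x => by
    refine (norm_sub_le _ _).trans ?_
    rw [norm_smul, he, mul_one, Real.norm_eq_abs]
    linarith [hinner x]
  set R := 2 * (‖x₀‖ + r) with hR
  set K := ‖fderiv ℝ γ 0‖ + L * R with hK
  have hK0 : 0 ≤ K := by positivity
  have hγL : ∀ a ∈ Metric.closedBall (0 : Rn n) R, ∀ b ∈ Metric.closedBall (0 : Rn n) R,
      ‖γ a - γ b‖ ≤ K * ‖a - b‖ := by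
    intro a ha b hb
    refine (convex_closedBall (0 : Rn n) R).norm_image_sub_le_of_norm_fderiv_le (𝕜 := ℝ)
      (fun x _ => (hγ.differentiable one_ne_zero) x) (fun x hx => ?_) hb ha
    have h1 := hL.dist_le_mul x 0
    rw [dist_eq_norm, dist_zero_right] at h1
    rw [mem_closedBall_zero_iff] at hx
    have h2 : ‖fderiv ℝ γ x‖ ≤ ‖fderiv ℝ γ 0‖ + ‖fderiv ℝ γ x - fderiv ℝ γ 0‖ := by
      simpa using norm_add_le (fderiv ℝ γ 0) (fderiv ℝ γ x - fderiv ℝ γ 0)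
    have h3 : (L : ℝ) * ‖x‖ ≤ L * R := by gcongr
    linarith
  set Λ := 1 + K * 2 with hΛ
  have hΛ1 : 1 ≤ Λ := by linarith
  have hhL : ∀ a ∈ Metric.ball x₀ r, ∀ b ∈ Metric.ball x₀ r, h a ≤ h b + Λ * dist a b := by
    intro a ha b hb
    have hmem : ∀ c ∈ Metric.ball x₀ r, c - ⟪e, c⟫ • e ∈ Metric.closedBall (0 : Rn n) R := by
      intro c hc
      rw [mem_closedBall_zero_iff]
      refine (hproj c).trans ?_
      have h1 : ‖c‖ ≤ ‖x₀‖ + ‖c - x₀‖ := by simpa using norm_add_le x₀ (c - x₀)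
      have h2 : ‖c - x₀‖ < r := by simpa [dist_eq_norm] using hc
      linarith
    have h1 := hγL _ (hmem b hb) _ (hmem a ha)
    rw [show b - ⟪e, b⟫ • e - (a - ⟪e, a⟫ • e) = (b - a) - ⟪e, b - a⟫ • e by
      rw [inner_sub_right, sub_smul]; abel] at h1
    have h2 := hproj (b - a)
    have h3 := hinner (a - b)
    rw [inner_sub_right] at h3
    have h4 := le_abs_self (⟪e, a⟫ - ⟪e, b⟫)
    have h5 := le_abs_self (γ (b - ⟪e, b⟫ • e) - γ (a - ⟪e, a⟫ • e))
    rw [Real.norm_eq_abs] at h1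
    rw [norm_sub_rev b a] at h2
    have h6 := mul_le_mul_of_nonneg_left h2 hK0
    have h7 : K * ‖b - a - ⟪e, b - a⟫ • e‖ ≤ K * (2 * ‖a - b‖) := h6
    rw [dist_eq_norm, hΛ]
    simp only [hh]
    linarith
  have hmemΩ : ∀ x ∈ Metric.ball x₀ r, x ∈ Ω ↔ 0 < h x := fun x hxb => by
    rw [hx x hxb, hh]; exact sub_pos.symm
  set V := 2 * volume.real (Metric.ball x₀ (2 * r)) / r with hV
  have hV0 : 0 ≤ V := by positivity
  -- `VΛ` serves the volume and `3Λ` the downward displacement. The bound `Λt < r/8` keeps the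
  -- displaced ball within `Metric.ball x₀ r`: `r/2 + 3r/8 + r/8 ≤ r`.
  refine ⟨V * Λ + 3 * Λ, r / (8 * Λ), by positivity, by positivity, fun t ht0 ht => ?_⟩
  rw [lt_div_iff₀ (by positivity)] at ht
  have htΛ : t ≤ Λ * t := le_mul_of_one_le_left ht0.le hΛ1
  have hc : 0 < Λ * t := by positivity
  have hlayer : ∀ x ∈ layer Ω (frontier Ω ∩ Metric.ball x₀ (r / 4)) t,
      dist x x₀ < r / 2 ∧ h x ≤ Λ * t := by
    rintro x ⟨hxΩ, z, ⟨hzf, hzb⟩, hxz⟩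
    rw [Metric.mem_ball] at hzb
    have h1 : dist x x₀ < r / 2 := by linarith [dist_triangle x z x₀]
    refine ⟨h1, ?_⟩
    have hz : z ∈ Metric.ball x₀ r := by rw [Metric.mem_ball]; linarith
    have hxb : x ∈ Metric.ball x₀ r := by rw [Metric.mem_ball]; linarith
    have hzΩ : z ∉ Ω := by
      rw [hΩ.frontier_eq] at hzf
      exact hzf.2
    rw [hmemΩ z hz, not_lt] at hzΩ
    have h2 := hhL x hxb z hz
    have h3 : Λ * dist x z ≤ Λ * t := by gcongr
    linarith
  refine ⟨?_, fun x hxl => ?_⟩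
  · refine (measure_mono (t := Metric.ball x₀ r ∩ h ⁻¹' Ioc 0 (Λ * t)) fun x hxl => ?_).trans
      ((volume_strip_le hhc.measurable he hshift x₀ hc (by linarith)).trans
        (ENNReal.ofReal_le_ofReal ?_))
    · obtain ⟨h1, h2⟩ := hlayer x hxl
      have hxb : x ∈ Metric.ball x₀ r := by rw [Metric.mem_ball]; linarith
      exact ⟨hxb, (hmemΩ x hxb).1 hxl.1, h2⟩
    · nlinarith
  · obtain ⟨h1, h2⟩ := hlayer x hxl
    have hdist : dist x (x - (3 * (Λ * t)) • e) = 3 * (Λ * t) := by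
      rw [dist_eq_norm, sub_sub_cancel, norm_smul, he, mul_one, Real.norm_of_nonneg (by positivity)]
    refine ⟨x - (3 * (Λ * t)) • e, ?_, ?_⟩
    · rw [hdist]
      nlinarith [mul_nonneg hV0 hc.le]
    · refine disjoint_left.2 fun q hq hqΩ => ?_
      rw [Metric.mem_ball] at hq
      have hyb : dist (x - (3 * (Λ * t)) • e) x₀ < r - t := by
        have := dist_triangle_left (x - (3 * (Λ * t)) • e) x₀ x
        linarith
      have hqb : q ∈ Metric.ball x₀ r := by
        rw [Metric.mem_ball]
        linarith [dist_triangle q (x - (3 * (Λ * t)) • e) x₀]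
      have h3 := hhL q hqb (x - (3 * (Λ * t)) • e) (by rw [Metric.mem_ball]; linarith)
      rw [hshift] at h3
      have h4 := (hmemΩ q hqb).1 hqΩ
      have h5 : Λ * dist q (x - (3 * (Λ * t)) • e) ≤ Λ * t := by gcongr
      linarith

/-- The property passes to subsets and finite unions and holds locally, so compactness of the
frontier gives it globally. -/
theorem thinLayer_frontier {Ω : Set (Rn n)} (hΩ : IsOpen Ω) (hb : Bornology.IsBounded Ω)
    (hbd : HasC11Boundary Ω) : ThinLayer Ω (frontier Ω) := by
  have hcomp : IsCompact (frontier Ω) :=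
    hb.isCompact_closure.of_isClosed_subset isClosed_frontier frontier_subset_closure
  refine hcomp.induction_on (thinLayer_empty Ω) (fun S T h => ThinLayer.mono h)
    (fun S T => ThinLayer.union) fun x₀ hx₀ => ?_
  obtain ⟨r, e, γ, hr, he, hγ, hL, hx⟩ := hbd x₀ hx₀
  exact ⟨_, inter_mem_nhdsWithin _ (Metric.ball_mem_nhds x₀ (by linarith)),
    thinLayer_of_epigraph hΩ hr he hγ hL hx⟩

/-- The points of `Ω` at distance at most `t` from the complement of `Ω`. -/
def innerLayer (Ω : Set (Rn n)) (t : ℝ) : Set (Rn n) := {x ∈ Ω | Metric.infDist x Ωᶜ ≤ t}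

theorem measurableSet_innerLayer {Ω : Set (Rn n)} (hΩ : IsOpen Ω) (t : ℝ) :
    MeasurableSet (innerLayer Ω t) :=
  hΩ.measurableSet.inter
    (measurableSet_le (Metric.continuous_infDist_pt Ωᶜ).measurable measurable_const)

/-- A nearest point of the complement lies on the frontier. The complement must be nonempty, as
`Metric.infDist` to the empty set is `0`. -/
theorem innerLayer_subset {Ω : Set (Rn n)} (hne : Ω ≠ univ) (t : ℝ) :
    innerLayer Ω t ⊆ layer Ω (frontier Ω) t := by
  rintro x ⟨hx, hd⟩
  obtain ⟨z, hz, he⟩ := exists_mem_frontier_infDist_compl_eq_dist hx hne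
  exact ⟨hx, z, hz, he ▸ hd⟩

end Geometry

/-! ### Smooth cutoff functions at scale `ε`. -/

section Cutoff

variable {n : ℕ}

/-- A cutoff function of `Ω` at scale `ε`. -/
structure IsCutoff (Ω : Set (Rn n)) (C ε : ℝ) (η : Rn n → ℝ) : Prop where
  contDiff : ContDiff ℝ (⊤ : ℕ∞) η
  tsupport_subset : tsupport η ⊆ Ω
  bound : ∀ x, ‖η x‖ ≤ 1
  eq_one : ∀ x ∈ Ω, x ∉ innerLayer Ω (3 * ε) → η =ᶠ[𝓝 x] fun _ => 1
  bound_pd : ∀ i x, ‖pd i η x‖ ≤ C / ε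
  bound_pd_pd : ∀ i j x, ‖pd i (pd j η) x‖ ≤ C / ε ^ 2

theorem norm_conv_indicator_le {k : Rn n → ℝ} {B ε : ℝ} {m : ℕ} (hε : 0 < ε) (hB : 0 ≤ B)
    (hk : ∀ z, ‖k z‖ ≤ B / ε ^ (n + m)) (hs : ∀ z, ε < ‖z‖ → k z = 0) {f : Rn n → ℝ}
    (hf : ∀ x, ‖f x‖ ≤ 1) (x : Rn n) : ‖conv k f x‖ ≤ B * unitVol n / ε ^ m := by
  have hu : 0 ≤ unitVol n := measureReal_nonneg
  have h := enorm_conv_le hk hs f x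
  have h2 : ∫⁻ y in Metric.closedBall x ε, ‖f y‖ₑ ≤ ENNReal.ofReal (ε ^ n * unitVol n) := by
    rw [← volume_closedBall_eq x hε.le]
    refine (lintegral_mono (g := fun _ => 1) fun y => ?_).trans (by simp)
    rw [← ofReal_norm]
    simpa using hf y
  have h3 := h.trans (mul_le_mul_right h2 _)
  rw [← ENNReal.ofReal_mul (by positivity), ← ofReal_norm,
    ENNReal.ofReal_le_ofReal_iff (by positivity)] at h3
  refine h3.trans (le_of_eq ?_)
  rw [pow_add]; field_simp

/-- Mollify at scale `ε` the indicator of the points at distance at least `2ε` from the complement: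
the result vanishes at distance below `ε` and equals `1` beyond `3ε`. -/
theorem exists_isCutoff (Ω : Set (Rn n)) :
    ∃ C : ℝ, 0 ≤ C ∧ ∀ ε : ℝ, 0 < ε → ∃ η : Rn n → ℝ, IsCutoff Ω C ε η := by
  obtain ⟨B, hB, H⟩ := exists_isMollifier n
  have hu : 0 ≤ unitVol n := measureReal_nonneg
  refine ⟨B * unitVol n, by positivity, fun ε hε => ?_⟩
  obtain ⟨ρ, hρ⟩ := H ε hε
  have hcont : Continuous fun x => Metric.infDist x Ωᶜ := Metric.continuous_infDist_pt _
  set A : Set (Rn n) := {x | 2 * ε ≤ Metric.infDist x Ωᶜ} with hA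
  have hAm : MeasurableSet A := (isClosed_le continuous_const hcont).measurableSet
  set f : Rn n → ℝ := A.indicator fun _ => 1 with hf
  have hfl : LocallyIntegrable f := (locallyIntegrable_const 1).indicator hAm
  have hf1 : ∀ x, ‖f x‖ ≤ 1 := fun x => by
    by_cases h : x ∈ A <;> simp [hf, h]
  have hpos : ∀ x, 0 < Metric.infDist x Ωᶜ → x ∈ Ω := fun x hx => by
    by_contra h
    rw [Metric.infDist_zero_of_mem (mem_compl h)] at hx
    exact lt_irrefl _ hx
  have e1 : ∀ i, pd i (conv ρ f) = conv (pd i ρ) f :=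
    fun i => pd_conv hρ.contDiff hρ.hasCompactSupport hfl i
  have e2 : ∀ i j, pd i (pd j (conv ρ f)) = conv (pd i (pd j ρ)) f := fun i j => by
    rw [e1, pd_conv (contDiff_pd hρ.contDiff j) (hasCompactSupport_pd hρ.hasCompactSupport j) hfl]
  refine ⟨conv ρ f, contDiff_conv hρ.contDiff hρ.hasCompactSupport hfl, ?_, fun x => ?_,
    fun x hx hl => ?_, fun i x => ?_, fun i j x => ?_⟩
  · have hsub : tsupport (conv ρ f) ⊆ {x | ε ≤ Metric.infDist x Ωᶜ} := by
      refine closure_minimal (fun x hx => ?_) (isClosed_le continuous_const hcont)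
      by_contra hlt
      rw [mem_ofPred_eq, not_le] at hlt
      refine hx (hρ.conv_eq_zero (Eventually.of_forall fun y hy => indicator_of_notMem ?_ _))
      have := Metric.infDist_le_infDist_add_dist (s := Ωᶜ) (x := y) (y := x)
      rw [Metric.mem_ball] at hy
      simp only [hA, mem_ofPred_eq, not_le]
      linarith
    exact fun x hx => hpos x (hε.trans_le (hsub hx))
  · exact hρ.norm_conv_le (Eventually.of_forall hf1) x
  · have hlt : 3 * ε < Metric.infDist x Ωᶜ := by
      by_contra h
      exact hl ⟨hx, not_lt.1 h⟩
    filter_upwards [(isOpen_lt continuous_const hcont).mem_nhds hlt] with z (hz : 3 * ε < Metric.infDist z Ωᶜ)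
    rw [← sub_eq_zero, hρ.conv_sub hfl]
    refine hρ.conv_eq_zero (Eventually.of_forall fun y hy => ?_)
    rw [sub_eq_zero]
    refine indicator_of_mem ?_ _
    have := Metric.infDist_le_infDist_add_dist (s := Ωᶜ) (x := z) (y := y)
    rw [Metric.mem_ball, dist_comm] at hy
    simp only [hA, mem_ofPred_eq]
    linarith
  · rw [e1]
    simpa using norm_conv_indicator_le hε hB (hρ.bound_pd i) (fun z hz => hρ.pd_eq_zero i z hz.le) hf1 x
  · rw [e2]
    exact norm_conv_indicator_le hε hB (hρ.bound_pd_pd i j) (hρ.pd_pd_eq_zero i j) hf1 x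

end Cutoff

/-! ### Energy of a smooth map after the cutoff. -/

section Energy

variable {n : ℕ}

theorem lintegral_le_of_le_add_indicator {Ω S : Set (Rn n)} (hS : MeasurableSet S)
    {f g : Rn n → ℝ≥0∞} {a b : ℝ≥0∞} (ha : a ≠ ∞)
    (h : ∀ᵐ x ∂volume.restrict Ω, f x ≤ a * g x + S.indicator (fun _ => b) x) :
    ∫⁻ x in Ω, f x ≤ a * (∫⁻ x in Ω, g x) + b * volume S := by
  refine (lintegral_mono_ae h).trans ?_
  rw [lintegral_add_right _ (measurable_const.indicator hS), lintegral_const_mul' _ _ ha,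
    lintegral_indicator hS]
  gcongr
  rw [setLIntegral_const]
  gcongr
  exact Measure.restrict_le_self

theorem norm_tensor1_smul_le {η : Rn n → ℝ} {w : Rn n → Rn n} (hη : ContDiff ℝ (⊤ : ℕ∞) η)
    (hw : ContDiff ℝ (⊤ : ℕ∞) w) {x : Rn n} {a L c : ℝ} (h1 : ‖η x‖ ≤ 1)
    (h2 : ∀ i, ‖pd i η x‖ ≤ a) (ha : 0 ≤ a) (hL : ‖tensor1 w x‖ ≤ L) (hc : ‖w x‖ ≤ c) :
    ‖tensor1 (fun x => η x • w x) x‖ ≤ Fintype.card (Fin 1 → Fin n) * (L + a * c) := by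
  have hL0 := (norm_nonneg _).trans hL
  have hc0 := (norm_nonneg _).trans hc
  refine norm_tensor_le (by positivity) fun J => ?_
  have e : tensor1 (fun x => η x • w x) x J = η x • tensor1 w x J + pd (J 0) η x • w x :=
    congrFun (pd_smul hη hw (J 0)) x
  rw [e]
  refine (norm_add_le _ _).trans ?_
  rw [norm_smul, norm_smul]
  have h3 := (norm_apply_le (tensor1 w x) J).trans hL
  have h4 : ‖η x‖ * ‖tensor1 w x J‖ ≤ 1 * L := by gcongr
  have h5 : ‖pd (J 0) η x‖ * ‖w x‖ ≤ a * c := by gcongr; exact h2 _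
  linarith

theorem norm_tensor2_smul_le {η : Rn n → ℝ} {w : Rn n → Rn n} (hη : ContDiff ℝ (⊤ : ℕ∞) η)
    (hw : ContDiff ℝ (⊤ : ℕ∞) w) {x : Rn n} {a a' L c : ℝ} (h1 : ‖η x‖ ≤ 1)
    (h2 : ∀ i, ‖pd i η x‖ ≤ a) (ha : 0 ≤ a) (h3 : ∀ i j, ‖pd i (pd j η) x‖ ≤ a') (ha' : 0 ≤ a')
    (hL : ‖tensor1 w x‖ ≤ L) (hc : ‖w x‖ ≤ c) :
    ‖tensor2 (fun x => η x • w x) x‖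
      ≤ Fintype.card (Fin 2 → Fin n) * (‖tensor2 w x‖ + 2 * a * L + a' * c) := by
  have hL0 := (norm_nonneg _).trans hL
  have hc0 := (norm_nonneg _).trans hc
  refine norm_tensor_le (by positivity) fun J => ?_
  have e : tensor2 (fun x => η x • w x) x J = (η x • tensor2 w x J + pd (J 0) η x • pd (J 1) w x) +
      (pd (J 1) η x • pd (J 0) w x + pd (J 0) (pd (J 1) η) x • w x) := by
    change pd (J 0) (pd (J 1) fun x => η x • w x) x = _
    have s1 := contDiff_pd hη (J 1)
    have s2 := contDiff_pd hw (J 1)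
    rw [pd_smul hη hw, pd_add (f := fun x => η x • pd (J 1) w x) (g := fun x => pd (J 1) η x • w x)
      (hη.smul s2) (s1.smul hw), pd_smul hη s2, pd_smul s1 hw]
    rfl
  rw [e]
  have hpd : ∀ i, ‖pd i w x‖ ≤ L := fun i => (norm_apply_le (tensor1 w x) fun _ => i).trans hL
  have h4 : ‖η x • tensor2 w x J‖ ≤ 1 * ‖tensor2 w x‖ := by
    rw [norm_smul]; gcongr; exact norm_apply_le _ _
  have h5 : ‖pd (J 0) η x • pd (J 1) w x‖ ≤ a * L := by
    rw [norm_smul]; gcongr; exacts [h2 _, hpd _]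
  have h6 : ‖pd (J 1) η x • pd (J 0) w x‖ ≤ a * L := by
    rw [norm_smul]; gcongr; exacts [h2 _, hpd _]
  have h7 : ‖pd (J 0) (pd (J 1) η) x • w x‖ ≤ a' * c := by
    rw [norm_smul]; gcongr; exact h3 _ _
  refine (norm_add_le _ _).trans ?_
  linarith [norm_add_le (η x • tensor2 w x J) (pd (J 0) η x • pd (J 1) w x),
    norm_add_le (pd (J 1) η x • pd (J 0) w x) (pd (J 0) (pd (J 1) η) x • w x)]

theorem norm_le_of_eq_zero {w : Rn n → Rn n} (hw : ContDiff ℝ (⊤ : ℕ∞) w) {L : ℝ}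
    (hL : ∀ x, ‖tensor1 w x‖ ≤ L) {x y : Rn n} (hy : w y = 0) : ‖w x‖ ≤ n * L * dist x y := by
  have h := convex_univ.norm_image_sub_le_of_norm_fderiv_le (𝕜 := ℝ) (f := w) (C := n * L)
    (fun x _ => (hw.differentiable (by simp)) x)
    (fun x _ => (norm_fderiv_le_tensor1 w x).trans (by gcongr; exact hL x))
    (mem_univ y) (mem_univ x)
  rwa [hy, sub_zero, ← dist_eq_norm] at h

theorem energy_le {Ω : Set (Rn n)} {K : Set (Matrix (Fin n) (Fin n) ℝ)}
    {M : Matrix (Fin n) (Fin n) ℝ} {p ε : ℝ} {u : Rn n → Rn n} {G : Rn n → Tensor n 1}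
    {H : Rn n → Tensor n 2} (hG : IsWeakDeriv univ 1 u G) (hH : IsWeakDeriv Ω 2 u H)
    (hM : ∀ᵐ x ∂volume.restrict (closure Ω)ᶜ, gradMatrix (G x) = M) :
    energy Ω K M p ε ≤ (∫⁻ x in Ω, Metric.infEDist (gradMatrix (G x)) K ^ 2) +
      ENNReal.ofReal (ε ^ p) * ∫⁻ x in Ω, ‖H x‖ₑ ^ p := by
  unfold energy
  refine iInf_le_of_le u (iInf_le_of_le G (iInf_le_of_le H ?_))
  rw [iInf_pos hG, iInf_pos hH, iInf_pos hM]

/-- `Mx + f` is a competitor, and `G + M`, which lies in `K`, bounds the distance of its gradient to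
`K`. -/
theorem energy_le_of_isTestFunction {Ω : Set (Rn n)} {K : Set (Matrix (Fin n) (Fin n) ℝ)}
    {M : Matrix (Fin n) (Fin n) ℝ} {p ε : ℝ} {G : Rn n → Tensor n 1}
    (hGK : ∀ᵐ x ∂volume.restrict Ω, gradMatrix (G x + matTensor M) ∈ K)
    {f : Rn n → Rn n} (hf : ContDiff ℝ (⊤ : ℕ∞) f) (hs : tsupport f ⊆ Ω) :
    energy Ω K M p ε ≤ (∫⁻ x in Ω, ‖tensor1 f x - G x‖ₑ ^ 2) +
      ENNReal.ofReal (ε ^ p) * ∫⁻ x in Ω, ‖tensor2 f x‖ₑ ^ p := by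
  have ha := contDiff_affine M 0
  set l : Rn n → Rn n := fun x => WithLp.toLp 2 (M *ᵥ x.ofLp) + 0 with hl
  have hu : ContDiff ℝ (⊤ : ℕ∞) fun x => l x + f x := ha.add hf
  have e1 : ∀ x, tensor1 (fun x => l x + f x) x = matTensor M + tensor1 f x := by
    intro x
    rw [← tensor1_affine M 0 x]
    ext J : 1
    exact congrFun (pd_add ha hf (J 0)) x
  have hll : ∀ i, pd i l = fun _ => matTensor M fun _ => i := fun i => by
    ext1 x
    rw [← tensor1_affine M 0 x]; rfl
  have e2 : ∀ x, tensor2 (fun x => l x + f x) x = tensor2 f x := by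
    intro x
    ext J : 1
    change pd (J 0) (pd (J 1) fun x => l x + f x) x = pd (J 0) (pd (J 1) f) x
    rw [pd_add ha hf, pd_add (contDiff_pd ha _) (contDiff_pd hf _), hll]
    simp [pd]
  refine (energy_le (isWeakDeriv_tensor1 hu univ) (isWeakDeriv_tensor2 hu Ω) ?_).trans ?_
  · filter_upwards [self_mem_ae_restrict isClosed_closure.isOpen_compl.measurableSet] with x hx
    have hz : f =ᶠ[𝓝 x] fun _ => 0 :=
      notMem_tsupport_iff_eventuallyEq.1 fun h => hx (subset_closure (hs h))
    have : tensor1 f x = 0 := by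
      ext J : 1
      change pd (J 0) f x = 0
      rw [(pd_congr hz (J 0)).eq_of_nhds]
      simp [pd]
    rw [e1, this, add_zero, gradMatrix_matTensor]
  · simp only [e2]
    gcongr ?_ + _
    refine lintegral_mono_ae ?_
    filter_upwards [hGK] with x hx
    gcongr
    refine (Metric.infEDist_le_edist_of_mem hx).trans (le_of_eq ?_)
    rw [edist_gradMatrix, e1, add_comm (G x), add_sub_add_left_eq_sub]

/-- Off the layer `S` the cutoff is locally `1` and costs nothing. On `S` the bound `‖w‖ ≤ Wε` keeps
the gradient of `η w` bounded and the extra second derivatives of order `1/ε`; since `S` has volume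
`O(ε)`, both energy terms gain `O(ε)`. -/
theorem energy_le_of_smooth {Ω : Set (Rn n)} (hΩ : IsOpen Ω) (hne : Ω ≠ univ)
    (hthin : ThinLayer Ω (frontier Ω)) {K : Set (Matrix (Fin n) (Fin n) ℝ)}
    {M : Matrix (Fin n) (Fin n) ℝ} {p : ℝ} (hp1 : 1 < p) (hp2 : p ≤ 2) {G : Rn n → Tensor n 1}
    {L : ℝ} (hL0 : 0 ≤ L) (hGL : ∀ᵐ x, ‖G x‖ ≤ L)
    (hGK : ∀ᵐ x ∂volume.restrict Ω, gradMatrix (G x + matTensor M) ∈ K) :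
    ∃ C ε₁ : ℝ, 0 ≤ C ∧ 0 < ε₁ ∧ ∀ ε, 0 < ε → ε < ε₁ → ∀ w : Rn n → Rn n,
      ContDiff ℝ (⊤ : ℕ∞) w → (∀ x, ‖tensor1 w x‖ ≤ L) →
      (∀ y, Disjoint (Metric.ball y ε) Ω → w y = 0) →
      energy Ω K M p ε ≤ ENNReal.ofReal C * (ENNReal.ofReal ε +
        (∫⁻ x in Ω, ‖tensor1 w x - G x‖ₑ ^ p) +
        ENNReal.ofReal (ε ^ p) * ∫⁻ x in Ω, ‖tensor2 w x‖ₑ ^ p) := by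
  obtain ⟨D, t₀, hD, ht₀, hthin⟩ := hthin
  obtain ⟨A, hA, hcut⟩ := exists_isCutoff Ω
  set W := n * L * (D * 3) with hW
  have hW0 : 0 ≤ W := by positivity
  set N₁ : ℝ := (Fintype.card (Fin 1 → Fin n) : ℝ)
  set N₂ : ℝ := (Fintype.card (Fin 2 → Fin n) : ℝ)
  have hN₁ : 0 ≤ N₁ := by positivity
  have hN₂ : 0 ≤ N₂ := by positivity
  set a := (2 * L) ^ (2 - p)
  have ha : 0 ≤ a := by positivity
  set b := (N₁ * (L + A * W) + L) ^ 2
  have hb : 0 ≤ b := by positivity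
  set a₂ := 2 ^ (p - 1) * (N₂ + 1) ^ p
  have ha₂ : 0 ≤ a₂ := by positivity
  set c := N₂ * (2 * A * L + A * W)
  have hc : 0 ≤ c := by positivity
  set b₂ := 2 ^ (p - 1) * c ^ p
  have hb₂ : 0 ≤ b₂ := by positivity
  refine ⟨a + b * (D * 3) + a₂ + b₂ * (D * 3), t₀ / 3, by positivity, by positivity,
    fun ε hε hε₁ w hw hwL hw0 => ?_⟩
  obtain ⟨η, hη⟩ := hcut ε hε
  obtain ⟨hvol, hext⟩ := hthin (3 * ε) (by positivity) (by linarith)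
  set S := innerLayer Ω (3 * ε) with hSdef
  have hSm : MeasurableSet S := measurableSet_innerLayer hΩ _
  have hSvol : volume S ≤ ENNReal.ofReal (D * 3 * ε) := by
    refine (measure_mono (innerLayer_subset hne _)).trans (hvol.trans (le_of_eq ?_))
    rw [mul_assoc]
  have hwS : ∀ x ∈ S, ‖w x‖ ≤ W * ε := by
    intro x hx
    obtain ⟨y, hy, hdis⟩ := hext x (innerLayer_subset hne _ hx)
    refine (norm_le_of_eq_zero hw hwL
      (hw0 y (hdis.mono_left (Metric.ball_subset_ball (by linarith))))).trans ?_
    calc n * L * dist x y ≤ n * L * (D * (3 * ε)) := by gcongr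
      _ = W * ε := by rw [hW]; ring
  set f : Rn n → Rn n := fun x => η x • w x with hf
  have hfs : ContDiff ℝ (⊤ : ℕ∞) f := hη.contDiff.smul hw
  have hsupp : tsupport f ⊆ Ω :=
    (tsupport_smul_subset_left η w).trans hη.tsupport_subset
  have hoff : ∀ x ∈ Ω, x ∉ S → tensor1 f x = tensor1 w x ∧ tensor2 f x = tensor2 w x := by
    intro x hx hxS
    have h : f =ᶠ[𝓝 x] w := by
      filter_upwards [hη.eq_one x hx hxS] with y hy
      simp [hf, hy]
    constructor
    · ext J : 1; exact (pd_congr h (J 0)).eq_of_nhds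
    · ext J : 1; exact (pd_congr (pd_congr h (J 1)) (J 0)).eq_of_nhds
  refine (energy_le_of_isTestFunction hGK hfs hsupp).trans ?_
  have hI₁ : ∫⁻ x in Ω, ‖tensor1 f x - G x‖ₑ ^ 2 ≤
      ENNReal.ofReal a * (∫⁻ x in Ω, ‖tensor1 w x - G x‖ₑ ^ p) + ENNReal.ofReal b * volume S := by
    refine lintegral_le_of_le_add_indicator hSm ENNReal.ofReal_ne_top ?_
    filter_upwards [ae_restrict_of_ae hGL, self_mem_ae_restrict hΩ.measurableSet] with x hx hxΩ
    by_cases hxS : x ∈ S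
    · rw [indicator_of_mem hxS]
      refine le_add_left ?_
      rw [← ofReal_norm, ← ENNReal.ofReal_pow (norm_nonneg _)]
      refine ENNReal.ofReal_le_ofReal (pow_le_pow_left₀ (norm_nonneg _) ?_ 2)
      refine (norm_sub_le _ _).trans (add_le_add ?_ hx)
      refine (norm_tensor1_smul_le hη.contDiff hw (hη.bound x) (fun i => hη.bound_pd i x)
        (by positivity) (hwL x) (hwS x hxS)).trans (le_of_eq ?_)
      congr 2
      field_simp
    · rw [indicator_of_notMem hxS, add_zero, (hoff x hxΩ hxS).1, ← ofReal_norm,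
        ← ENNReal.ofReal_pow (norm_nonneg _), ENNReal.ofReal_rpow_of_nonneg (norm_nonneg _) (by linarith),
        ← ENNReal.ofReal_mul ha]
      refine ENNReal.ofReal_le_ofReal ?_
      set t := ‖tensor1 w x - G x‖
      have ht : t ≤ 2 * L := (norm_sub_le _ _).trans (by linarith [hwL x])
      have ht0 : 0 ≤ t := norm_nonneg _
      -- Here `p ≤ 2` enters: the factor `t ^ (2 - p)` is at most `(2L) ^ (2 - p)`.
      have e : t ^ 2 = t ^ (2 - p) * t ^ p := by
        rw [← Real.rpow_add_of_nonneg ht0 (by linarith) (by linarith)]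
        norm_num
      rw [e]
      have := Real.rpow_le_rpow ht0 ht (by linarith : 0 ≤ 2 - p)
      gcongr
  have hI₂ : ∫⁻ x in Ω, ‖tensor2 f x‖ₑ ^ p ≤
      ENNReal.ofReal a₂ * (∫⁻ x in Ω, ‖tensor2 w x‖ₑ ^ p) +
        ENNReal.ofReal (b₂ / ε ^ p) * volume S := by
    refine lintegral_le_of_le_add_indicator hSm ENNReal.ofReal_ne_top ?_
    filter_upwards [self_mem_ae_restrict hΩ.measurableSet] with x hxΩ
    have h2 : (2 : ℝ≥0∞) ^ (p - 1) = ENNReal.ofReal (2 ^ (p - 1)) := by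
      rw [← ENNReal.ofReal_rpow_of_nonneg (by norm_num) (by linarith)]; norm_num
    -- The factor `N₂ + 1` covers both cases: `N₂` comes from the product rule on `S`, and off `S` a
    -- factor at least `1` is needed.
    have key : ‖tensor2 f x‖ₑ ≤ ENNReal.ofReal (N₂ + 1) * ‖tensor2 w x‖ₑ
        + S.indicator (fun _ => ENNReal.ofReal (c / ε)) x := by
      by_cases hxS : x ∈ S
      · rw [indicator_of_mem hxS, ← ofReal_norm, ← ofReal_norm,
          ← ENNReal.ofReal_mul (by positivity), ← ENNReal.ofReal_add (by positivity) (by positivity)]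
        refine ENNReal.ofReal_le_ofReal ?_
        refine (norm_tensor2_smul_le hη.contDiff hw (hη.bound x) (fun i => hη.bound_pd i x)
          (by positivity) (fun i j => hη.bound_pd_pd i j x) (by positivity) (hwL x)
          (hwS x hxS)).trans ?_
        have e : N₂ * (‖tensor2 w x‖ + 2 * (A / ε) * L + A / ε ^ 2 * (W * ε))
            = N₂ * ‖tensor2 w x‖ + c / ε := by
          simp only [c]; field_simp; ring
        rw [e]
        nlinarith [norm_nonneg (tensor2 w x)]
      · rw [indicator_of_notMem hxS, add_zero, (hoff x hxΩ hxS).2]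
        refine le_mul_of_one_le_left zero_le ?_
        rw [ENNReal.one_le_ofReal]
        linarith
    refine (ENNReal.rpow_le_rpow key (by linarith)).trans
      ((ENNReal.rpow_add_le_mul_rpow_add_rpow _ _ hp1.le).trans (le_of_eq ?_))
    rw [mul_add, ENNReal.mul_rpow_of_nonneg _ _ (by linarith), ← mul_assoc, h2,
      ENNReal.ofReal_rpow_of_nonneg (by positivity) (by linarith),
      ← ENNReal.ofReal_mul (by positivity)]
    congr 1
    by_cases hxS : x ∈ S
    · rw [indicator_of_mem hxS, indicator_of_mem hxS,
        ENNReal.ofReal_rpow_of_nonneg (by positivity) (by linarith),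
        ← ENNReal.ofReal_mul (by positivity), Real.div_rpow hc hε.le, mul_div_assoc]
    · rw [indicator_of_notMem hxS, indicator_of_notMem hxS, ENNReal.zero_rpow_of_pos (by linarith),
        mul_zero]
  set I₁ := ∫⁻ x in Ω, ‖tensor1 w x - G x‖ₑ ^ p
  set I₂ := ∫⁻ x in Ω, ‖tensor2 w x‖ₑ ^ p
  have hS₁ : ENNReal.ofReal b * volume S ≤ ENNReal.ofReal (b * (D * 3)) * ENNReal.ofReal ε := by
    rw [ENNReal.ofReal_mul hb, mul_assoc, ← ENNReal.ofReal_mul (by positivity)]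
    gcongr
  have hS₂ : ENNReal.ofReal (ε ^ p) * (ENNReal.ofReal (b₂ / ε ^ p) * volume S)
      ≤ ENNReal.ofReal (b₂ * (D * 3)) * ENNReal.ofReal ε := by
    rw [← mul_assoc, ← ENNReal.ofReal_mul (by positivity),
      mul_div_cancel₀ _ (by positivity : ε ^ p ≠ 0), ENNReal.ofReal_mul hb₂, mul_assoc,
      ← ENNReal.ofReal_mul (by positivity)]
    gcongr
  calc _ ≤ (ENNReal.ofReal a * I₁ + ENNReal.ofReal b * volume S) + ENNReal.ofReal (ε ^ p) *
        (ENNReal.ofReal a₂ * I₂ + ENNReal.ofReal (b₂ / ε ^ p) * volume S) := by gcongr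
    _ ≤ (ENNReal.ofReal a * I₁ + ENNReal.ofReal (b * (D * 3)) * ENNReal.ofReal ε) +
        (ENNReal.ofReal a₂ * (ENNReal.ofReal (ε ^ p) * I₂) +
          ENNReal.ofReal (b₂ * (D * 3)) * ENNReal.ofReal ε) := by
      rw [mul_add (ENNReal.ofReal (ε ^ p)), mul_left_comm (ENNReal.ofReal (ε ^ p)) (ENNReal.ofReal a₂)]
      gcongr
    _ ≤ _ := by
      rw [ENNReal.ofReal_add (by positivity) (by positivity),
        ENNReal.ofReal_add (by positivity) (by positivity),
        ENNReal.ofReal_add (by positivity) (by positivity)]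
      set T := ENNReal.ofReal ε + I₁ + ENNReal.ofReal (ε ^ p) * I₂ with hT
      have t1 : ENNReal.ofReal ε ≤ T := by rw [hT, add_assoc]; exact le_self_add
      have t2 : I₁ ≤ T := by
        rw [hT, add_assoc]; exact le_add_left le_self_add
      have t3 : ENNReal.ofReal (ε ^ p) * I₂ ≤ T := le_add_self
      rw [add_mul, add_mul, add_mul, add_assoc (_ + _)]
      gcongr

end Energy

/-! ### Mollification estimates in fractional and integer Sobolev spaces. -/

section Estimates

variable {n : ℕ}

theorem enorm_tensor_rpow_le {k : ℕ} {T : Tensor n k} {p : ℝ} (hp : 0 < p) {q : ℝ≥0∞}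
    (h : ∀ J, ‖T J‖ₑ ^ p ≤ q) :
    ‖T‖ₑ ^ p ≤ ENNReal.ofReal ((Fintype.card (Fin k → Fin n) : ℝ) ^ p) * q := by
  rcases isEmpty_or_nonempty (Fin k → Fin n) with he | hne
  · have : T = 0 := by ext J : 1; exact he.elim J
    simp [this, hp]
  · obtain ⟨J, hJ⟩ := Finite.exists_max fun J => ‖T J‖
    have h1 := norm_tensor_le (norm_nonneg (T J)) hJ
    have h2 : ‖T‖ₑ ≤ ENNReal.ofReal (Fintype.card (Fin k → Fin n)) * ‖T J‖ₑ := by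
      rw [← ofReal_norm, ← ofReal_norm, ← ENNReal.ofReal_mul (by positivity)]
      exact ENNReal.ofReal_le_ofReal h1
    refine (ENNReal.rpow_le_rpow h2 hp.le).trans ?_
    rw [ENNReal.mul_rpow_of_nonneg _ _ hp.le, ENNReal.ofReal_rpow_of_nonneg (by positivity) hp.le]
    gcongr
    exact h J

/-- The inner integral of the Gagliardo seminorm controls mean oscillations. -/
theorem setLIntegral_closedBall_le_gagliardo {G : Rn n → Tensor n 1} {s p δ : ℝ} (hs : 0 < s)
    (hp : 1 < p) (hδ : 0 < δ) (x : Rn n) :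
    ∫⁻ y in Metric.closedBall x δ, ‖G y - G x‖ₑ ^ p ≤ ENNReal.ofReal (δ ^ (n + s * p)) *
      ∫⁻ y, ‖G x - G y‖ₑ ^ p / edist x y ^ ((n : ℝ) + s * p) := by
  have hpos : 0 < (n : ℝ) + s * p := by positivity
  rw [← lintegral_const_mul' _ _ ENNReal.ofReal_ne_top]
  refine le_trans (setLIntegral_mono' measurableSet_closedBall fun y hy => ?_)
    (setLIntegral_le_lintegral _ _)
  rcases eq_or_ne x y with rfl | hxy
  · simp [show 0 < p by linarith]
  · have h0 : edist x y ^ ((n : ℝ) + s * p) ≠ 0 := by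
      simp [ENNReal.rpow_eq_zero_iff, hpos.not_gt, hxy, edist_ne_top]
    have h1 : edist x y ^ ((n : ℝ) + s * p) ≠ ∞ :=
      ENNReal.rpow_ne_top_of_nonneg hpos.le (edist_ne_top _ _)
    rw [← edist_eq_enorm_sub, edist_comm (G y), edist_eq_enorm_sub]
    calc ‖G x - G y‖ₑ ^ p = edist x y ^ ((n : ℝ) + s * p) *
          (‖G x - G y‖ₑ ^ p / edist x y ^ ((n : ℝ) + s * p)) := (ENNReal.mul_div_cancel h0 h1).symm
      _ ≤ _ := by
        gcongr
        rw [← ENNReal.ofReal_rpow_of_nonneg hδ.le hpos.le]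
        gcongr
        rw [edist_dist, dist_comm]
        exact ENNReal.ofReal_le_ofReal hy

/-- Averaging over the ball costs `δ^(-(n + mp))`, while the Gagliardo weight on that ball gains
`δ^(n + sp)`. The case `m = 0` gives the approximation error, `m = 1` the second derivatives. -/
theorem enorm_conv_sub_rpow_le {G : Rn n → Tensor n 1} (hG : LocallyIntegrable G) {s p δ B : ℝ}
    (hs : 0 < s) (hp : 1 < p) (hδ : 0 < δ) (hB : 0 ≤ B) {k : Rn n → ℝ} {m : ℕ}
    (hk : ∀ z, ‖k z‖ ≤ B / δ ^ (n + m)) (hk0 : ∀ z, δ < ‖z‖ → k z = 0) (x : Rn n) :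
    ‖conv k (fun y => G y - G x) x‖ₑ ^ p ≤
      ENNReal.ofReal (B ^ p * unitVol n ^ (p - 1) * δ ^ (s * p - m * p)) *
        ∫⁻ y, ‖G x - G y‖ₑ ^ p / edist x y ^ ((n : ℝ) + s * p) := by
  have hu : 0 ≤ unitVol n := measureReal_nonneg
  refine (enorm_conv_rpow_le_of_scaled hp hB hδ hk hk0
    (hG.aestronglyMeasurable.sub aestronglyMeasurable_const) x).trans ?_
  refine (mul_le_mul_right (setLIntegral_closedBall_le_gagliardo hs hp hδ x) _).trans ?_
  rw [← mul_assoc, ← ENNReal.ofReal_mul (by positivity), mul_assoc (B ^ p * _), ← Real.rpow_add hδ]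
  refine le_of_eq ?_
  congr 4
  ring

theorem lintegral_conv_sub_le_gagliardo {G : Rn n → Tensor n 1} (hG : LocallyIntegrable G)
    {s p δ B : ℝ} (hs : 0 < s) (hp : 1 < p) (hδ : 0 < δ) (hB : 0 ≤ B) {ρ : Rn n → ℝ}
    (hρ : IsMollifier B δ ρ) :
    ∫⁻ x, ‖conv ρ G x - G x‖ₑ ^ p ≤
      ENNReal.ofReal (B ^ p * unitVol n ^ (p - 1) * δ ^ (s * p)) * gagliardo s p G := by
  rw [gagliardo, ← lintegral_const_mul' _ _ ENNReal.ofReal_ne_top]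
  refine lintegral_mono fun x => ?_
  simp only
  rw [hρ.conv_sub hG]
  simpa using enorm_conv_sub_rpow_le (m := 0) hG hs hp hδ hB hρ.bound (fun z hz => hρ.eq_zero z hz.le) x

theorem lintegral_tensor2_conv_le_gagliardo {v : Rn n → Rn n} {G : Rn n → Tensor n 1}
    (hv : IsWeakDeriv univ 1 v G) {s p δ B : ℝ} (hs : 0 < s) (hp : 1 < p) (hδ : 0 < δ)
    (hB : 0 ≤ B) {ρ : Rn n → ℝ} (hρ : IsMollifier B δ ρ) :
    ∫⁻ x, ‖tensor2 (conv ρ v) x‖ₑ ^ p ≤ ENNReal.ofReal ((Fintype.card (Fin 2 → Fin n) : ℝ) ^ p *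
      (B ^ p * unitVol n ^ (p - 1) * δ ^ (s * p - p))) * gagliardo s p G := by
  have hG := locallyIntegrableOn_univ.1 hv.2.1
  rw [gagliardo, ← lintegral_const_mul' _ _ ENNReal.ofReal_ne_top]
  refine lintegral_mono fun x => ?_
  simp only
  rw [ENNReal.ofReal_mul (by positivity), mul_assoc]
  refine enorm_tensor_rpow_le (by linarith) fun J => ?_
  have hc := hasCompactSupport_pd hρ.hasCompactSupport (J 1)
  have hd := contDiff_pd hρ.contDiff (J 1)
  have e : conv (pd (J 1) ρ) G x = conv (pd (J 1) ρ) (fun y => G y - G x) x := by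
    rw [conv_sub_const hd.continuous hc hG, conv_pd_const hρ.contDiff hρ.hasCompactSupport, sub_zero]
  rw [tensor2_conv_apply hρ.contDiff hρ.hasCompactSupport hv, e]
  have h := enorm_conv_sub_rpow_le (m := 1) hG hs hp hδ hB (hρ.bound_pd (J 1))
    (fun z hz => hρ.pd_eq_zero (J 1) z hz.le) x
  rw [Nat.cast_one, one_mul] at h
  refine le_trans (ENNReal.rpow_le_rpow ?_ (by linarith)) h
  rw [← ofReal_norm, ← ofReal_norm]
  exact ENNReal.ofReal_le_ofReal (norm_apply_le _ _)

/-- Fubini on `{dist y x ≤ δ}` produces the ball volume `δ ^ n * unitVol n`, which cancels the power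
of `δ` in the pointwise bound. The constant is therefore independent of `δ`. -/
theorem lintegral_conv_rpow_le {F : Type*} [NormedAddCommGroup F] [NormedSpace ℝ F]
    {D : Rn n → F} (hD : LocallyIntegrable D) {p δ B : ℝ} (hp : 1 < p)
    (hδ : 0 < δ) (hB : 0 ≤ B) {ρ : Rn n → ℝ} (hρ : IsMollifier B δ ρ) :
    ∫⁻ x, ‖conv ρ D x‖ₑ ^ p ≤ ENNReal.ofReal (B ^ p * unitVol n ^ p) * ∫⁻ x, ‖D x‖ₑ ^ p := by
  have hu : 0 ≤ unitVol n := measureReal_nonneg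
  have hm : AEMeasurable fun y => ‖D y‖ₑ ^ p := (hD.aestronglyMeasurable.enorm).pow_const p
  have hS : MeasurableSet {z : Rn n × Rn n | dist z.2 z.1 ≤ δ} :=
    (isClosed_le (continuous_snd.dist continuous_fst) continuous_const).measurableSet
  have hmS : AEMeasurable (fun z : Rn n × Rn n =>
      {z : Rn n × Rn n | dist z.2 z.1 ≤ δ}.indicator (fun z => ‖D z.2‖ₑ ^ p) z)
      (volume.prod volume) := (hm.comp_snd).indicator hS
  have swap : ∫⁻ x, ∫⁻ y in Metric.closedBall x δ, ‖D y‖ₑ ^ p =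
      ENNReal.ofReal (δ ^ n * unitVol n) * ∫⁻ y, ‖D y‖ₑ ^ p := by
    calc _ = ∫⁻ x, ∫⁻ y, {z : Rn n × Rn n | dist z.2 z.1 ≤ δ}.indicator
            (fun z => ‖D z.2‖ₑ ^ p) (x, y) := by
          refine lintegral_congr fun x => ?_
          rw [← lintegral_indicator measurableSet_closedBall]
          rfl
      _ = ∫⁻ y, ∫⁻ x, {z : Rn n × Rn n | dist z.2 z.1 ≤ δ}.indicator
            (fun z => ‖D z.2‖ₑ ^ p) (x, y) := lintegral_lintegral_swap hmS
      _ = ∫⁻ y, ENNReal.ofReal (δ ^ n * unitVol n) * ‖D y‖ₑ ^ p := by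
          refine lintegral_congr fun y => ?_
          have e : ∀ x, {z : Rn n × Rn n | dist z.2 z.1 ≤ δ}.indicator
              (fun z => ‖D z.2‖ₑ ^ p) (x, y)
              = (Metric.closedBall y δ).indicator (fun _ => ‖D y‖ₑ ^ p) x := by
            intro x
            by_cases h : dist y x ≤ δ
            · rw [indicator_of_mem (show (x, y) ∈ {z : Rn n × Rn n | dist z.2 z.1 ≤ δ} from h),
                indicator_of_mem (by rwa [Metric.mem_closedBall, dist_comm])]
            · rw [indicator_of_notMem (show (x, y) ∉ {z : Rn n × Rn n | dist z.2 z.1 ≤ δ} from h),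
                indicator_of_notMem (by rwa [Metric.mem_closedBall, dist_comm])]
          simp_rw [e]
          rw [lintegral_indicator measurableSet_closedBall, setLIntegral_const,
            volume_closedBall_eq y hδ.le, mul_comm]
      _ = _ := lintegral_const_mul' _ _ ENNReal.ofReal_ne_top
  calc _ ≤ ∫⁻ x, ENNReal.ofReal (B ^ p * unitVol n ^ (p - 1) * δ ^ (-(n + (0 : ℕ) * p))) *
        ∫⁻ y in Metric.closedBall x δ, ‖D y‖ₑ ^ p :=
      lintegral_mono fun x => enorm_conv_rpow_le_of_scaled hp hB hδ hρ.bound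
        (fun z hz => hρ.eq_zero z hz.le) hD.aestronglyMeasurable x
    _ = _ := by
      rw [lintegral_const_mul' _ _ ENNReal.ofReal_ne_top, swap, ← mul_assoc,
        ← ENNReal.ofReal_mul (by positivity)]
      congr 2
      have h1 : unitVol n ^ p = unitVol n ^ (p - 1) * unitVol n := by
        rw [← Real.rpow_add_one' hu (by linarith), sub_add_cancel]
      rw [h1, Nat.cast_zero, zero_mul, add_zero, Real.rpow_neg hδ.le, Real.rpow_natCast]
      field_simp

/-- At a Lebesgue point the error is at most `B * unitVol n` times the mean oscillation over the
ball of radius `δ k`. -/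
theorem tendsto_conv {F : Type*} [NormedAddCommGroup F] [NormedSpace ℝ F] [CompleteSpace F]
    {G : Rn n → F} (hG : LocallyIntegrable G) {B : ℝ} (hB : 0 ≤ B) {δ : ℕ → ℝ}
    (hδ : ∀ k, 0 < δ k) (hδ0 : Tendsto δ atTop (𝓝 0)) {ρ : ℕ → Rn n → ℝ}
    (hρ : ∀ k, IsMollifier B (δ k) (ρ k)) :
    ∀ᵐ x, Tendsto (fun k => conv (ρ k) G x) atTop (𝓝 (G x)) := by
  have hδ' : Tendsto δ atTop (𝓝[>] 0) :=
    tendsto_nhdsWithin_iff.2 ⟨hδ0, Eventually.of_forall fun k => hδ k⟩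
  filter_upwards [IsUnifLocDoublingMeasure.ae_tendsto_average_norm_sub volume hG 1] with x hx
  have h := hx (fun _ => x) δ hδ'
    (Eventually.of_forall fun k => Metric.mem_closedBall_self (by simpa using (hδ k).le))
  rw [tendsto_iff_norm_sub_tendsto_zero]
  refine squeeze_zero (fun k => norm_nonneg _) (fun k => ?_) (by simpa using h.const_mul (B * unitVol n))
  have hi : IntegrableOn (fun y => G y - G x) (Metric.closedBall x (δ k)) :=
    (hG.sub (locallyIntegrable_const _)).integrableOn_isCompact (isCompact_closedBall _ _)
  have h1 := enorm_conv_le (hρ k).bound (fun z hz => (hρ k).eq_zero z hz.le) (fun y => G y - G x) x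
  have hd := hδ k
  rw [← ofReal_integral_norm_eq_lintegral_enorm hi, ← ENNReal.ofReal_mul (by positivity),
    ← ofReal_norm, ENNReal.ofReal_le_ofReal_iff (mul_nonneg (by positivity)
      (integral_nonneg fun _ => norm_nonneg _))] at h1
  rw [(hρ k).conv_sub hG]
  refine h1.trans (le_of_eq ?_)
  have hu : 0 < unitVol n :=
    ENNReal.toReal_pos (Metric.measure_ball_pos _ _ one_pos).ne' measure_ball_lt_top.ne
  have hvol : volume.real (Metric.closedBall x (δ k)) = δ k ^ n * unitVol n := by
    rw [Measure.real, volume_closedBall_eq x hd.le, ENNReal.toReal_ofReal (by positivity)]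
  rw [setAverage_eq, hvol, smul_eq_mul, add_zero]
  field_simp

theorem tendsto_lintegral_conv_sub {F : Type*} [NormedAddCommGroup F] [NormedSpace ℝ F]
    [CompleteSpace F] {G : Rn n → F} (hG : LocallyIntegrable G) {L : ℝ}
    (hL : ∀ᵐ x, ‖G x‖ ≤ L) {Ω : Set (Rn n)} (hΩ : Bornology.IsBounded Ω) {p : ℝ} (hp : 0 < p)
    {B : ℝ} (hB : 0 ≤ B) {δ : ℕ → ℝ} (hδ : ∀ k, 0 < δ k) (hδ0 : Tendsto δ atTop (𝓝 0))
    {ρ : ℕ → Rn n → ℝ} (hρ : ∀ k, IsMollifier B (δ k) (ρ k)) :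
    Tendsto (fun k => ∫⁻ x in Ω, ‖conv (ρ k) G x - G x‖ₑ ^ p) atTop (𝓝 0) := by
  have h := tendsto_lintegral_of_dominated_convergence' (μ := volume.restrict Ω)
    (F := fun k x => ‖conv (ρ k) G x - G x‖ₑ ^ p) (f := fun _ => 0)
    (fun _ => ENNReal.ofReal (L + L) ^ p) (fun k => ?_) (fun k => ?_) ?_ ?_
  · simpa using h
  · exact (((contDiff_conv (hρ k).contDiff (hρ k).hasCompactSupport
      hG).continuous.aestronglyMeasurable.sub hG.aestronglyMeasurable).enorm.pow_const p).restrict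
  · filter_upwards [ae_restrict_of_ae hL] with x hx
    refine ENNReal.rpow_le_rpow ?_ hp.le
    rw [← ofReal_norm]
    exact ENNReal.ofReal_le_ofReal
      ((norm_sub_le _ _).trans (add_le_add ((hρ k).norm_conv_le hL x) hx))
  · rw [lintegral_const, Measure.restrict_apply_univ]
    exact ENNReal.mul_ne_top (ENNReal.rpow_ne_top_of_nonneg hp.le ENNReal.ofReal_ne_top)
      hΩ.measure_lt_top.ne
  · filter_upwards [ae_restrict_of_ae (tendsto_conv hG hB hδ hδ0 hρ)] with x hx
    have h1 : Tendsto (fun k => ‖conv (ρ k) G x - G x‖ₑ) atTop (𝓝 0) := by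
      have := (hx.sub_const (G x)).enorm
      simpa using this
    have h2 := (ENNReal.continuous_rpow_const (y := p)).tendsto 0 |>.comp h1
    simpa [Function.comp_def, hp] using h2

end Estimates

/-! ### Upper bounds for the energy and comparison with the lower bound. -/

section Scaling

variable {n : ℕ} {Ω : Set (Rn n)} {K : Set (Matrix (Fin n) (Fin n) ℝ)}
  {M : Matrix (Fin n) (Fin n) ℝ} {p : ℝ}

/-- In dimension zero second derivatives have no entries, so `u` itself is a competitor of zero
energy. This case is separate because a bounded `Ω` can then be the whole space. -/
theorem energy_dim_zero {K : Set (Matrix (Fin 0) (Fin 0) ℝ)} {Ω : Set (Rn 0)}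
    {M : Matrix (Fin 0) (Fin 0) ℝ} {u : Rn 0 → Rn 0} (hp : 0 < p) (hu : IsSolution Ω K M u) (ε : ℝ) :
    energy Ω K M p ε = 0 := by
  obtain ⟨G, hG, hGK, hGM⟩ := hu
  have hH : IsWeakDeriv Ω 2 u (fun _ => 0) :=
    ⟨hG.1.mono_set (subset_univ _), locallyIntegrableOn_const _, fun φ _ J => (J 0).elim0⟩
  refine le_antisymm ((energy_le hG hH hGM).trans (le_of_eq ?_)) zero_le
  have h1 : ∫⁻ x in Ω, Metric.infEDist (gradMatrix (G x)) K ^ 2 = 0 := by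
    rw [lintegral_congr_ae (g := fun _ => 0), lintegral_zero]
    filter_upwards [hGK] with x hx
    simp [Metric.infEDist_zero_of_mem hx]
  simp [h1, hp]

theorem ne_univ_of_isBounded (hn : n ≠ 0) (hb : Bornology.IsBounded Ω) : Ω ≠ univ := by
  rintro rfl
  have : Nonempty (Fin n) := ⟨⟨0, Nat.pos_of_ne_zero hn⟩⟩
  exact NormedSpace.unbounded_univ ℝ (Rn n) hb

/-- The energy of the mollified and cut off map. -/
theorem energy_le_of_isMollifier (hΩ : IsOpen Ω) (hne : Ω ≠ univ)
    (hthin : ThinLayer Ω (frontier Ω)) (hp1 : 1 < p) (hp2 : p ≤ 2) {v : Rn n → Rn n}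
    {G : Rn n → Tensor n 1} (hv : IsWeakDeriv univ 1 v G) {L : ℝ} (hL0 : 0 ≤ L)
    (hGL : ∀ᵐ x, ‖G x‖ ≤ L)
    (hGK : ∀ᵐ x ∂volume.restrict Ω, gradMatrix (G x + matTensor M) ∈ K)
    (hv0 : ∀ᵐ x ∂volume.restrict (closure Ω)ᶜ, v x = 0) :
    ∃ C ε₁ : ℝ, 0 ≤ C ∧ 0 < ε₁ ∧ ∀ ε, 0 < ε → ε < ε₁ → ∀ (B δ : ℝ) (ρ : Rn n → ℝ),
      IsMollifier B δ ρ → δ ≤ ε →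
      energy Ω K M p ε ≤ ENNReal.ofReal C * (ENNReal.ofReal ε +
        (∫⁻ x in Ω, ‖conv ρ G x - G x‖ₑ ^ p) +
        ENNReal.ofReal (ε ^ p) * ∫⁻ x in Ω, ‖tensor2 (conv ρ v) x‖ₑ ^ p) := by
  obtain ⟨C, ε₁, hC, hε₁, H⟩ := energy_le_of_smooth hΩ hne hthin hp1 hp2 hL0 hGL hGK
  refine ⟨C, ε₁, hC, hε₁, fun ε h0 h1 B δ ρ hρ hδ => ?_⟩
  have hvl := locallyIntegrableOn_univ.1 hv.1
  have e := tensor1_conv hρ.contDiff hρ.hasCompactSupport hv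
  have := H ε h0 h1 (conv ρ v) (contDiff_conv hρ.contDiff hρ.hasCompactSupport hvl)
    (fun x => by rw [e]; exact hρ.norm_conv_le hGL x) fun y hy => ?_
  · rwa [e] at this
  · refine hρ.conv_eq_zero ?_
    rw [ae_restrict_iff' isClosed_closure.isOpen_compl.measurableSet] at hv0
    filter_upwards [hv0] with z hz hzb
    have hd := hy.closure_right Metric.isOpen_ball
    exact hz (disjoint_left.1 hd (Metric.ball_subset_ball hδ hzb))

/-- Upper bound for the energy of a solution with fractional Sobolev regularity of its gradient. -/
theorem energy_le_of_gagliardo (hΩ : IsOpen Ω) (hne : Ω ≠ univ)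
    (hthin : ThinLayer Ω (frontier Ω)) (hp1 : 1 < p) (hp2 : p ≤ 2) {v : Rn n → Rn n}
    {G : Rn n → Tensor n 1} (hv : IsWeakDeriv univ 1 v G) {L : ℝ} (hL0 : 0 ≤ L)
    (hGL : ∀ᵐ x, ‖G x‖ ≤ L)
    (hGK : ∀ᵐ x ∂volume.restrict Ω, gradMatrix (G x + matTensor M) ∈ K)
    (hv0 : ∀ᵐ x ∂volume.restrict (closure Ω)ᶜ, v x = 0) {s : ℝ} (hs : 0 < s)
    (hg : gagliardo s p G < ∞) :
    ∃ C ε₁ : ℝ, 0 ≤ C ∧ 0 < ε₁ ∧ ∀ ε, 0 < ε → ε < ε₁ →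
      energy Ω K M p ε ≤ ENNReal.ofReal (C * ε ^ min 1 (s * p)) := by
  obtain ⟨C, ε₁, hC, hε₁, H⟩ := energy_le_of_isMollifier hΩ hne hthin hp1 hp2 hv hL0 hGL hGK hv0
  obtain ⟨B, hB, hmol⟩ := exists_isMollifier n
  have hu : 0 ≤ unitVol n := measureReal_nonneg
  set g := (gagliardo s p G).toReal
  have hg' : gagliardo s p G = ENNReal.ofReal g := (ENNReal.ofReal_toReal hg.ne).symm
  have hg0 : 0 ≤ g := ENNReal.toReal_nonneg
  set b := B ^ p * unitVol n ^ (p - 1)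
  have hb : 0 ≤ b := by positivity
  set N : ℝ := (Fintype.card (Fin 2 → Fin n) : ℝ) ^ p
  have hN : 0 ≤ N := by positivity
  refine ⟨C * (1 + b * g + N * b * g), min ε₁ 1, by positivity, by positivity, fun ε h0 h1 => ?_⟩
  have h1' : ε < 1 := h1.trans_le (min_le_right _ _)
  -- Taking `δ = ε` balances the approximation error and the weighted second derivatives.
  obtain ⟨ρ, hρ⟩ := hmol ε h0
  refine (H ε h0 (h1.trans_le (min_le_left _ _)) B ε ρ hρ le_rfl).trans ?_
  have hG := locallyIntegrableOn_univ.1 hv.2.1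
  have hI₁ := (setLIntegral_le_lintegral Ω _).trans
    (lintegral_conv_sub_le_gagliardo hG hs hp1 h0 hB hρ)
  have hI₂ := (setLIntegral_le_lintegral Ω _).trans
    (lintegral_tensor2_conv_le_gagliardo hv hs hp1 h0 hB hρ)
  rw [hg', ← ENNReal.ofReal_mul (by positivity)] at hI₁ hI₂
  calc _ ≤ ENNReal.ofReal C * (ENNReal.ofReal ε + ENNReal.ofReal (b * ε ^ (s * p) * g) +
        ENNReal.ofReal (ε ^ p) * ENNReal.ofReal (N * (b * ε ^ (s * p - p)) * g)) := by gcongr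
    _ = ENNReal.ofReal (C * (ε + b * ε ^ (s * p) * g +
        ε ^ p * (N * (b * ε ^ (s * p - p)) * g))) := by
      rw [← ENNReal.ofReal_mul (by positivity), ← ENNReal.ofReal_add (by positivity) (by positivity),
        ← ENNReal.ofReal_add (by positivity) (by positivity), ← ENNReal.ofReal_mul hC]
    _ ≤ _ := by
      refine ENNReal.ofReal_le_ofReal ?_
      have e1 : ε ^ p * ε ^ (s * p - p) = ε ^ (s * p) := by
        rw [← Real.rpow_add h0]; congr 1; ring
      have e2 : ε ^ p * (N * (b * ε ^ (s * p - p)) * g) = N * b * g * ε ^ (s * p) := by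
        rw [← e1]; ring
      have e3 : ε ≤ ε ^ min 1 (s * p) := by
        simpa using Real.rpow_le_rpow_of_exponent_ge h0 h1'.le (min_le_left 1 (s * p))
      have e4 : ε ^ (s * p) ≤ ε ^ min 1 (s * p) :=
        Real.rpow_le_rpow_of_exponent_ge h0 h1'.le (min_le_right 1 (s * p))
      rw [e2, mul_assoc C]
      refine mul_le_mul_of_nonneg_left ?_ hC
      have h3 := mul_le_mul_of_nonneg_left e4 (by positivity : 0 ≤ b * g)
      have h4 := mul_le_mul_of_nonneg_left e4 (by positivity : 0 ≤ N * b * g)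
      linarith

/-- Upper bound for the energy of a solution with an integrable second derivative. -/
theorem energy_le_of_second_deriv (hΩ : IsOpen Ω) (hΩb : Bornology.IsBounded Ω) (hne : Ω ≠ univ)
    (hthin : ThinLayer Ω (frontier Ω)) (hp1 : 1 < p) (hp2 : p ≤ 2) {v : Rn n → Rn n}
    {G : Rn n → Tensor n 1} (hv : IsWeakDeriv univ 1 v G) {L : ℝ} (hL0 : 0 ≤ L)
    (hGL : ∀ᵐ x, ‖G x‖ ≤ L)
    (hGK : ∀ᵐ x ∂volume.restrict Ω, gradMatrix (G x + matTensor M) ∈ K)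
    (hv0 : ∀ᵐ x ∂volume.restrict (closure Ω)ᶜ, v x = 0) {D : Rn n → Tensor n 2}
    (hD : IsWeakDeriv univ 2 v D) (hDp : ∫⁻ x, ‖D x‖ₑ ^ p < ∞) :
    ∃ C ε₁ : ℝ, 0 ≤ C ∧ 0 < ε₁ ∧ ∀ ε, 0 < ε → ε < ε₁ →
      energy Ω K M p ε ≤ ENNReal.ofReal (C * ε) := by
  obtain ⟨C, ε₁, hC, hε₁, H⟩ := energy_le_of_isMollifier hΩ hne hthin hp1 hp2 hv hL0 hGL hGK hv0
  obtain ⟨B, hB, hmol⟩ := exists_isMollifier n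
  have hu : 0 ≤ unitVol n := measureReal_nonneg
  set g := (∫⁻ x, ‖D x‖ₑ ^ p).toReal
  have hg' : ∫⁻ x, ‖D x‖ₑ ^ p = ENNReal.ofReal g := (ENNReal.ofReal_toReal hDp.ne).symm
  have hg0 : 0 ≤ g := ENNReal.toReal_nonneg
  set b := B ^ p * unitVol n ^ p
  have hb : 0 ≤ b := by positivity
  refine ⟨C * (2 + b * g), min ε₁ 1, by positivity, by positivity, fun ε h0 h1 => ?_⟩
  have h1' : ε < 1 := h1.trans_le (min_le_right _ _)
  -- With `∇²v ∈ L^p` the second-derivative bound is uniform in the mollification scale. That scale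
  -- can thus tend to `0` at fixed `ε`, and no rate of convergence is needed.
  choose ρ hρ using fun k : ℕ => hmol (1 / ((k : ℝ) + 1)) Nat.one_div_pos_of_nat
  have hlim := tendsto_one_div_add_atTop_nhds_zero_nat (𝕜 := ℝ)
  have hconv := tendsto_lintegral_conv_sub (locallyIntegrableOn_univ.1 hv.2.1) hGL hΩb
    (by linarith : 0 < p) hB (fun k => Nat.one_div_pos_of_nat) hlim hρ
  obtain ⟨k, hk1, hk2⟩ := ((hconv.eventually_le_const
    (ENNReal.ofReal_pos.2 h0)).and (hlim.eventually_le_const h0)).exists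
  refine (H ε h0 (h1.trans_le (min_le_left _ _)) B _ (ρ k) (hρ k) hk2).trans ?_
  have hI₂ := (setLIntegral_le_lintegral Ω _).trans
    (lintegral_conv_rpow_le (locallyIntegrableOn_univ.1 hD.2.1) hp1 Nat.one_div_pos_of_nat hB (hρ k))
  rw [hg', ← ENNReal.ofReal_mul (by positivity)] at hI₂
  rw [tensor2_conv (hρ k).contDiff (hρ k).hasCompactSupport hD]
  calc _ ≤ ENNReal.ofReal C * (ENNReal.ofReal ε + ENNReal.ofReal ε +
        ENNReal.ofReal (ε ^ p) * ENNReal.ofReal (b * g)) := by gcongr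
    _ = ENNReal.ofReal (C * (ε + ε + ε ^ p * (b * g))) := by
      rw [← ENNReal.ofReal_mul (by positivity), ← ENNReal.ofReal_add (by positivity) (by positivity),
        ← ENNReal.ofReal_add (by positivity) (by positivity), ← ENNReal.ofReal_mul hC]
    _ ≤ _ := by
      refine ENNReal.ofReal_le_ofReal ?_
      have e : ε ^ p ≤ ε := by
        simpa using Real.rpow_le_rpow_of_exponent_ge h0 h1'.le hp1.le
      rw [mul_assoc C]
      refine mul_le_mul_of_nonneg_left ?_ hC
      have h4 := mul_le_mul_of_nonneg_right e (by positivity : 0 ≤ b * g)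
      linarith

/-- The lower scaling bound excludes upper bounds with a larger exponent. -/
theorem not_lower_bound_of_upper_bound {E : ℝ → ℝ≥0∞} {C C' ε₀ ε₁ μ κ : ℝ} (hC : 0 ≤ C) (hε₀ : 0 < ε₀)
    (hlower : ∀ ε, 0 < ε → ε < ε₀ → ENNReal.ofReal (ε ^ μ) ≤ ENNReal.ofReal C * E ε)
    (hC' : 0 ≤ C') (hε₁ : 0 < ε₁)
    (hupper : ∀ ε, 0 < ε → ε < ε₁ → E ε ≤ ENNReal.ofReal (C' * ε ^ κ)) : κ ≤ μ := by
  by_contra! hμκ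
  have hlim : Tendsto (fun ε : ℝ => C * C' * ε ^ (κ - μ)) (𝓝[>] 0) (𝓝 0) := by
    have h : Tendsto (fun ε : ℝ => ε ^ (κ - μ)) (𝓝 0) (𝓝 0) := by
      have := (Real.continuousAt_rpow_const 0 (κ - μ) (.inr (by linarith))).tendsto
      rwa [Real.zero_rpow (by linarith)] at this
    simpa using (h.mono_left nhdsWithin_le_nhds).const_mul (C * C')
  obtain ⟨ε, h1, h2, h3⟩ := ((hlim.eventually_lt_const one_pos).and
    (Ioo_mem_nhdsGT (lt_min hε₀ hε₁))).exists
  have hε : 0 < ε := h2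
  have h := (hlower ε hε (h3.trans_le (min_le_left _ _))).trans
    (mul_le_mul_right (hupper ε hε (h3.trans_le (min_le_right _ _))) _)
  rw [← ENNReal.ofReal_mul hC, ENNReal.ofReal_le_ofReal_iff (by positivity)] at h
  have e : ε ^ κ = ε ^ (κ - μ) * ε ^ μ := by rw [← Real.rpow_add hε]; simp
  have hpos : 0 < ε ^ μ := by positivity
  rw [e] at h
  nlinarith

theorem exists_ae_norm_le {F : Type*} [NormedAddCommGroup F] {G : Rn n → F}
    (hG : MemLp G ∞ volume) : ∃ L : ℝ, 0 ≤ L ∧ ∀ᵐ x, ‖G x‖ ≤ L := by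
  refine ⟨(eLpNormEssSup G volume).toReal, ENNReal.toReal_nonneg, ?_⟩
  have hfin : eLpNormEssSup G volume ≠ ∞ := by
    have := hG.2
    rw [eLpNorm_exponent_top] at this
    exact this.ne
  filter_upwards [ae_le_eLpNormEssSup (f := G) (μ := volume)] with x hx
  have := ENNReal.toReal_mono hfin hx
  simpa using this

/-- Sobolev regularity of order above one gives either a finite Gagliardo seminorm of the gradient
or an integrable second derivative. -/
theorem MemSobolev.gagliardo_or_second_deriv {v : Rn n → Rn n} {s : ℝ} (hs : 0 < s) (hp : 0 < p)
    (h : MemSobolev (1 + s) p v) :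
    (∃ G : Rn n → Tensor n 1, IsWeakDeriv univ 1 v G ∧ gagliardo s p G < ∞) ∨
      ∃ D : Rn n → Tensor n 2, IsWeakDeriv univ 2 v D ∧ ∫⁻ x, ‖D x‖ₑ ^ p < ∞ := by
  obtain ⟨-, ⟨-, h⟩ | ⟨h, -⟩⟩ := h
  swap
  · linarith
  unfold sobolevNorm at h
  obtain ⟨D, h⟩ := iInf_lt_iff.1 h
  obtain ⟨hD, h⟩ := iInf_lt_iff.1 h
  rw [ENNReal.rpow_lt_top_iff_of_pos (by positivity), ENNReal.add_lt_top, ENNReal.sum_lt_top] at h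
  -- For `s < 1` the integer part of `1 + s` is `1`, leaving the Gagliardo integral of order `s` of
  -- the gradient; otherwise it is at least `2` and the norm contains `∇²v`.
  rcases lt_or_ge s 1 with hs1 | hs1
  · left
    have hf : ⌊1 + s⌋₊ = 1 := by
      rw [Nat.floor_eq_iff (by positivity)]
      constructor <;> norm_num <;> linarith
    have h2 := h.2
    rw [hf] at h2 hD
    rw [if_neg (by simpa using hs.ne')] at h2
    refine ⟨D 1, hD 1 le_rfl, ?_⟩
    simpa using h2
  · right
    have hf : 2 ≤ ⌊1 + s⌋₊ := Nat.le_floor (by norm_num; linarith)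
    exact ⟨D 2, hD 2 hf, h.1 2 (Finset.mem_range.2 (by omega))⟩

end Scaling

end WellScaling

/-! ### The theorem. -/

open WellScaling
theorem mainTheorem3 {n m : ℕ} (Ω : Set (Rn n)) (hΩ_open : IsOpen Ω)
    (hΩ_bdd : Bornology.IsBounded Ω) (hΩ_bdry : HasC11Boundary Ω)
    (θ θc : ℝ) (hθ : 0 < θ) (hθc : 0 < θc)
    (α : ℝ → ℝ) (hα : ∀ τ, 0 < τ → 0 < α τ)
    (U : Fin m → ℝ → Matrix (Fin n) (Fin n) ℝ) (hU : ∀ j τ, 0 < τ → (U j τ)ᵀ = U j τ)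
    (M : Matrix (Fin n) (Fin n) ℝ) (p : ℝ) (hp1 : 1 < p) (hp2 : p ≤ 2)
    (C μ ε₀ : ℝ) (hC : 1 < C) (hμ0 : 0 < μ) (hμ1 : μ < 1 / 2) (hε₀ : 0 < ε₀)
    (hlower : ∀ ε : ℝ, 0 < ε → ε < ε₀ →
      ENNReal.ofReal (ε ^ (2 * μ)) ≤ ENNReal.ofReal C * energy Ω (wells θc α U θ) M p ε)
    (u : Rn n → Rn n) (hu : IsSolution Ω (wells θc α U θ) M u)
    (b : Rn n) (s : ℝ)
    (hv_mem : MemSobolev (1 + s) p (shift M b u))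
    (hv_supp : ∀ᵐ x ∂volume.restrict (closure Ω)ᶜ, shift M b u x = 0)
    (hv_grad : HasBoundedGradient (shift M b u)) :
    s ≤ 2 * μ / p := by
  have hp0 : 0 < p := by linarith
  by_contra! hs
  have hs0 : 0 < s := lt_trans (by positivity) hs
  have hsp : 2 * μ < s * p := by rwa [div_lt_iff₀ hp0] at hs
  rcases eq_or_ne n 0 with rfl | hn
  · have h := hlower (ε₀ / 2) (by positivity) (by linarith)
    rw [energy_dim_zero hp0 hu, mul_zero, nonpos_iff_eq_zero, ENNReal.ofReal_eq_zero] at h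
    have : 0 < (ε₀ / 2) ^ (2 * μ) := by positivity
    linarith
  have hne := ne_univ_of_isBounded hn hΩ_bdd
  have hthin := thinLayer_frontier hΩ_open hΩ_bdd hΩ_bdry
  obtain ⟨G, hG, hGtop⟩ := hv_grad
  obtain ⟨L, hL0, hGL⟩ := exists_ae_norm_le hGtop
  obtain ⟨Gu, hGu, hGuK, -⟩ := hu
  have hGK : ∀ᵐ x ∂volume.restrict Ω, gradMatrix (G x + matTensor M) ∈ wells θc α U θ := by
    filter_upwards [hGuK, ae_restrict_of_ae (hG.ae_eq (isWeakDeriv_shift hGu))] with x hx hxe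
    rwa [hxe, sub_add_cancel]
  rcases hv_mem.gagliardo_or_second_deriv hs0 hp0 with ⟨D, hD, hg⟩ | ⟨D, hD, hDp⟩
  · have hDG := hD.ae_eq hG
    have hDL : ∀ᵐ x, ‖D x‖ ≤ L := by
      filter_upwards [hDG, hGL] with x h1 h2
      rwa [h1]
    have hDK : ∀ᵐ x ∂volume.restrict Ω, gradMatrix (D x + matTensor M) ∈ wells θc α U θ := by
      filter_upwards [ae_restrict_of_ae hDG, hGK] with x h1 h2
      rwa [h1]
    obtain ⟨C', ε₁, hC', hε₁, hupper⟩ := energy_le_of_gagliardo hΩ_open hne hthin hp1 hp2 hD hL0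
      hDL hDK hv_supp hs0 hg
    have := not_lower_bound_of_upper_bound (by linarith) hε₀ hlower hC' hε₁ hupper
    -- If the minimum is `1`, this contradicts `2μ < 1`; if it is `s * p`, it contradicts `2μ < s *
    -- p`.
    rcases min_choice 1 (s * p) with h | h <;> rw [h] at this <;> linarith
  · obtain ⟨C', ε₁, hC', hε₁, hupper⟩ := energy_le_of_second_deriv hΩ_open hΩ_bdd hne hthin hp1 hp2
      hG hL0 hGL hGK hv_supp hD hDp
    have := not_lower_bound_of_upper_bound (κ := 1) (by linarith) hε₀ hlower hC' hε₁
      (by simpa only [Real.rpow_one] using hupper)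
    linarith
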